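/- **Setting.** Let $n\ge 1$. A Markov control model with state space $\{1,\dots,n\}$ consists of a topological space $A$ with its Borel $\sigma$-algebra and, for each state $i$, a nonempty Borel set $A_i\subset A$ of actions, a measurable reward $a\mapsto r_i^a\in\mathbb R$ on $A_i$, and a measurable map $a\mapsto P_i^a$ from $A_i$ to the stochastic vectors of $\mathbb R^n$, such that for all $i$ and all $x\in\mathbb R^n$ the supremum $\sup_{a\in A_i}(r_i^a+P_i^a x)$ is attained (and finite). Its dynamic programming operator is $f:\mathbb R^n\to\mathbb R^n$, $f_i(x)=\sup_{a\in A_i}(r_i^a+P_i^a x)$. A randomized strategy $\gamma$ assigns to each $k\ge 0$ and each partial history of states $(i_0,\dots,i_k)$ a probability measure $\gamma_k^{i_0,\dots,i_k}$ on $A$ giving probability $1$ to $A_{i_k}$. With an initial state $i$, it defines a state-action process $(\xi_k,\alpha_k)_{k\ge0}$: $\xi_0=i$; given the past and $\xi_k$, the action $\alpha_k$ has law $\gamma_k^{\xi_0,\dots,\xi_k}$; given the past and $\alpha_k$, the state $\xi_{k+1}$ has law $P^{\alpha_k}_{\xi_k}$. The mean reward is $$\mu_i^\gamma=\liminf_{N\to\infty}\frac1N\,\mathbb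 E^{\gamma,i}\bigl(r_{\xi_0}^{\alpha_0}+\dots+r_{\xi_{N-1}}^{\alpha_{N-1}}\bigr)\in[-\infty,+\infty).$$ A randomized Markovian stationary strategy $\tau^\infty$ is given by probability measures $\tau_1,\dots,\tau_n$ on $A$ with $\tau_i[A_i]=1$, by taking $\gamma_k^{i_0,\dots,i_k}=\tau_{i_k}$; write $\mu^\tau=\mu^{\tau^\infty}$, $P^\tau_{ij}=\int_A P^a_{ij}\,d\tau_i(a)$ and $r^\tau_i=\int_A r_i^a\,d\tau_i(a)\in\mathbb R\cup\{-\infty\}$. A class of a stochastic matrix $P$ is a strongly connected component of the directed graph on $\{1,\dots,n\}$ with an arc $i\to j$ whenever $P_{ij}\ne0$; it is final if no node of it has access to a node outside it. If $F$ is a final class of $P^\tau$, then $m_F^\tau$ denotes the unique invariant measure of the $F\times F$ submatrix of $P^\tau$ (the unique stochastic row vector $m$ with $m\,P^\tau_{FF}=m$), and $r^\tau_F$ the restriction of $r^\tau$ to $F$. For $v\in\mathbb R^n$ let $\partial f(v)=\{P\in\mathbb R^{n\times n} : f(x)-f(v)\ge P(x-v)\ \text{for all } x\in\mathbb R^n\}$;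 its elements are stochastic matrices. Let $C^{\rm c}(f)$ be the set of all final classes of all matrices $P\in\partial f(u)$, where $u$ is an eigenvector of $f$; this set does not depend on the choice of $u$. **Proposition.** Assume that $f$ has an eigenvector $u\in\mathbb R^n$ with eigenvalue $\lambda\in\mathbb R$, that is, $f_i(u)=\lambda+u_i$ for all $i$. Then $$\lambda=\max_{\gamma,\ 1\le i\le n}\mu_i^\gamma=\max_{\tau^\infty,\ 1\le i\le n}\mu_i^\tau ,$$ where the maxima, which are attained, are taken over all randomized strategies $\gamma$ and over all randomized Markovian stationary strategies $\tau^\infty$, respectively. For every randomized Markovian stationary strategy $\tau^\infty$, each final class $F$ of $P^\tau$ has a unique invariant measure $m^\tau_F$ as above, and $$\max_{1\le i\le n}\mu_i^\tau=\max_{F\text{ final class of }P^\tau} m_F^\tau r_F^\tau .$$ Moreover, if all the $A_i$ are compact and all the maps $a\mapsto r_i^a$ and $a\mapsto P_i^a$ are continuous on $A_i$, then the elements of $C^{\rm c}(f)$, computed from any eigenvector $u$, are precisely the sets $F$ such that, for some randomized Markovian stationary strategy $\tau^\infty$, $F$ is a final class of $P^\tau$ and $m_F^\tau r_F^\tau=\lambda$.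 -/

import Mathlib

open MeasureTheory ProbabilityTheory Filter

/-! ### Classes of nonnegative matrices, invariant measures, subdifferentials -/

/-- `i` has access to `j` in the directed graph of `P` (the graph with an arc `k → l` whenever
`P k l ≠ 0`): there is a directed path from `i` to `j`, or `i = j`. -/
def HasAccess {n : ℕ} (P : Matrix (Fin n) (Fin n) ℝ) (i j : Fin n) : Prop :=
  Relation.ReflTransGen (fun k l => P k l ≠ 0) i j

/-- `C` is a class of `P`: an equivalence class of mutual access in the graph of `P`. -/
def IsClassOf {n : ℕ} (P : Matrix (Fin n) (Fin n) ℝ) (C : Finset (Fin n)) : Prop :=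
  ∃ i, ∀ j, j ∈ C ↔ HasAccess P i j ∧ HasAccess P j i

/-- `C` is a final class of `P`: a class with no access to its complement. -/
def IsFinalClass {n : ℕ} (P : Matrix (Fin n) (Fin n) ℝ) (C : Finset (Fin n)) : Prop :=
  IsClassOf P C ∧ ∀ i ∈ C, ∀ j, HasAccess P i j → j ∈ C

/-- `m` is an invariant measure of the `F × F` submatrix of `P`: a stochastic row vector `m`
indexed by `F` with `m P_FF = m`. -/
def IsInvariantMeasureOn {n : ℕ} (P : Matrix (Fin n) (Fin n) ℝ) (F : Finset (Fin n))
    (m : F → ℝ) : Prop :=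
  m ∈ stdSimplex ℝ F ∧
    Matrix.vecMul m (P.submatrix (fun i : F => (i : Fin n)) (fun i : F => (i : Fin n))) = m

open Classical in
/-- The invariant measure of the `F × F` submatrix of `P`, when there is one
(it exists and is unique when `P` is stochastic and `F` is a final class of `P`). -/
noncomputable def invariantMeasureOn {n : ℕ} (P : Matrix (Fin n) (Fin n) ℝ)
    (F : Finset (Fin n)) : F → ℝ :=
  if h : ∃ m, IsInvariantMeasureOn P F m then h.choose else 0

/-- The subdifferential `∂f(v)` of a map `f : ℝⁿ → ℝⁿ`, a set of `n × n` matrices. -/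
def subdifferential {n : ℕ} (f : (Fin n → ℝ) → (Fin n → ℝ)) (v : Fin n → ℝ) :
    Set (Matrix (Fin n) (Fin n) ℝ) :=
  {P | ∀ x, P.mulVec (x - v) ≤ f x - f v}

/-- `C^f(𝒫)`: the set of all final classes of the matrices `P ∈ 𝒫`. -/
def finalClasses {n : ℕ} (S : Set (Matrix (Fin n) (Fin n) ℝ)) : Set (Finset (Fin n)) :=
  {F | ∃ P ∈ S, IsFinalClass P F}

/-- The family `C^c(f)` of final classes of matrices `P ∈ ∂f(v)`, for an eigenvector `v` of `f`.
It does not depend on the choice of the eigenvector `v`. -/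
def criticalFinalClasses {n : ℕ} (f : (Fin n → ℝ) → (Fin n → ℝ)) (v : Fin n → ℝ) :
    Set (Finset (Fin n)) :=
  finalClasses (subdifferential f v)

/-- `u` is an eigenvector of `f` with (additive) eigenvalue `lam`: `f(u) = lam + u`. -/
def IsAddEigenvector {n : ℕ} (f : (Fin n → ℝ) → (Fin n → ℝ)) (lam : ℝ) (u : Fin n → ℝ) : Prop :=
  ∀ i, f u i = lam + u i

/-- Expectation, with values in `[-∞, +∞]`, of a real random variable bounded from above:
`E[g⁺] - E[g⁻]`. -/
noncomputable def extMean {Ω : Type*} [MeasurableSpace Ω] (μ : Measure Ω) (g : Ω → ℝ) : EReal :=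
  ((∫⁻ ω, ENNReal.ofReal (g ω) ∂μ : ENNReal) : EReal) -
    ((∫⁻ ω, ENNReal.ofReal (-g ω) ∂μ : ENNReal) : EReal)

/-! ### Markov control models -/

/-- A Markov control model with state space `Fin n` and action space `A`: nonempty Borel sets
`act i ⊆ A` of admissible actions, measurable instantaneous rewards and transition probabilities
on them, such that `sup_{a ∈ A_i} (r_i^a + P_i^a x)` is attained for all `x`. -/
structure MarkovControlModel (n : ℕ) (A : Type*) [TopologicalSpace A] [MeasurableSpace A]
    [BorelSpace A] where
  /-- The set `A_i` of actions that may be played in state `i`. -/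
  act : Fin n → Set A
  act_nonempty : ∀ i, (act i).Nonempty
  measurableSet_act : ∀ i, MeasurableSet (act i)
  /-- The reward `r_i^a`. -/
  reward : ∀ i, act i → ℝ
  measurable_reward : ∀ i, Measurable (reward i)
  /-- The stochastic vector `P_i^a`. -/
  trans : ∀ i, act i → stdSimplex ℝ (Fin n)
  measurable_trans : ∀ i, Measurable (trans i)
  attained : ∀ (i : Fin n) (x : Fin n → ℝ), ∃ a : act i, ∀ b : act i,
    reward i b + ∑ j, trans i b j * x j ≤ reward i a + ∑ j, trans i a j * x j

namespace MarkovControlModel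

variable {n : ℕ} {A : Type*} [TopologicalSpace A] [MeasurableSpace A] [BorelSpace A]

/-- The dynamic programming operator `f_i(x) = sup_{a ∈ A_i} (r_i^a + P_i^a x)`. -/
noncomputable def dpOperator (M : MarkovControlModel n A) (x : Fin n → ℝ) : Fin n → ℝ :=
  fun i => ⨆ a : M.act i, (M.reward i a + ∑ j, M.trans i a j * x j)

open Classical in
/-- The reward as a function on all of `A`; the (irrelevant) value outside `A_i` is `0`. -/
noncomputable def rewardExt (M : MarkovControlModel n A) (i : Fin n) (a : A) : ℝ :=
  if h : a ∈ M.act i then M.reward i ⟨a, h⟩ else 0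

open Classical in
/-- The transition probabilities as functions on all of `A`; the (irrelevant) value outside `A_i`
is the Dirac mass at `i`. -/
noncomputable def transExt (M : MarkovControlModel n A) (i : Fin n) (a : A) : Fin n → ℝ :=
  if h : a ∈ M.act i then (M.trans i ⟨a, h⟩ : Fin n → ℝ) else Pi.single i 1

theorem measurable_transExt (M : MarkovControlModel n A) (i j : Fin n) :
    Measurable fun a => M.transExt i a j := by
  classical
  have h1 : Measurable fun a : M.act i => M.trans i a j :=
    (measurable_pi_apply j).comp (measurable_subtype_coe.comp (M.measurable_trans i))
  have h2 : (fun a => M.transExt i a j) = fun a =>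
      if h : a ∈ M.act i then M.trans i ⟨a, h⟩ j else (Pi.single i 1 : Fin n → ℝ) j := by
    funext a
    unfold transExt
    split_ifs <;> rfl
  rw [h2]
  exact Measurable.dite h1 measurable_const (M.measurableSet_act i)

theorem transExt_nonneg (M : MarkovControlModel n A) (i : Fin n) (a : A) (j : Fin n) :
    0 ≤ M.transExt i a j := by
  unfold transExt
  split_ifs with h
  · exact (M.trans i ⟨a, h⟩).2.1 j
  · by_cases hij : j = i
    · subst hij; simp
    · simp [hij]

theorem sum_transExt (M : MarkovControlModel n A) (i : Fin n) (a : A) :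
    ∑ j, M.transExt i a j = 1 := by
  unfold transExt
  split_ifs with h
  · exact (M.trans i ⟨a, h⟩).2.2
  · simp

/-- The law of the next state, given the present state and action. -/
noncomputable def stateKernel (M : MarkovControlModel n A) : Kernel (Fin n × A) (Fin n) where
  toFun p := ∑ j, ENNReal.ofReal (M.transExt p.1 p.2 j) • Measure.dirac j
  measurable' := by
    refine Measure.measurable_of_measurable_coe _ fun s _ => ?_
    simp only [Measure.coe_finsetSum, Finset.sum_apply, Measure.smul_apply, smul_eq_mul]
    refine Finset.measurable_sum _ fun j _ => Measurable.mul_const ?_ _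
    refine ENNReal.measurable_ofReal.comp ?_
    exact measurable_from_prod_countable_right fun i => M.measurable_transExt i j

instance (M : MarkovControlModel n A) : IsMarkovKernel M.stateKernel where
  isProbabilityMeasure p := ⟨by
    change (∑ j, ENNReal.ofReal (M.transExt p.1 p.2 j) • Measure.dirac j : Measure (Fin n))
      Set.univ = 1
    simp only [Measure.coe_finsetSum, Finset.sum_apply, Measure.smul_apply, smul_eq_mul,
      measure_univ, mul_one]
    rw [← ENNReal.ofReal_sum_of_nonneg fun j _ => M.transExt_nonneg _ _ j, sum_transExt,
      ENNReal.ofReal_one]⟩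

/-- A (randomized) strategy: to each time `k` and each partial history `(i_0, …, i_k)` of states,
it associates a probability measure on `A` giving probability one to `A_{i_k}`. -/
structure Strategy (M : MarkovControlModel n A) where
  law : (k : ℕ) → (Finset.Iic k → Fin n) → Measure A
  isProb : ∀ k h, IsProbabilityMeasure (law k h)
  law_act : ∀ k h, law k h (M.act (h ⟨k, Finset.mem_Iic.2 le_rfl⟩)) = 1

/-- A family `τ = (τ_i)` of probability measures on `A` with `τ_i[A_i] = 1`: the data of a
(randomized) Markovian stationary strategy `τ^∞`. -/
structure StationaryRule (M : MarkovControlModel n A) where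
  law : Fin n → Measure A
  isProb : ∀ i, IsProbabilityMeasure (law i)
  law_act : ∀ i, law i (M.act i) = 1

variable {M : MarkovControlModel n A}

/-- The Markovian stationary strategy `τ^∞`. -/
def StationaryRule.toStrategy (τ : M.StationaryRule) : M.Strategy where
  law k h := τ.law (h ⟨k, Finset.mem_Iic.2 le_rfl⟩)
  isProb _ _ := τ.isProb _
  law_act _ _ := τ.law_act _

/-- Given the state-action pairs up to time `k` and the state at time `k + 1`, the partial history
of states up to time `k + 1`. -/
def nextHistory {n : ℕ} {A : Type*} (k : ℕ) (p : (Finset.Iic k → Fin n × A) × Fin n) : Finset.Iic (k + 1) → Fin n :=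
  fun j => if h : (j : ℕ) ≤ k then (p.1 ⟨j, Finset.mem_Iic.2 h⟩).1 else p.2

theorem measurable_nextHistory {n : ℕ} {A : Type*} [MeasurableSpace A] (k : ℕ) :
    Measurable (nextHistory (n := n) (A := A) k) := by
  refine measurable_pi_lambda _ fun j => ?_
  unfold nextHistory
  split_ifs with h
  · exact measurable_fst.comp ((measurable_pi_apply _).comp measurable_fst)
  · exact measurable_snd

/-- The law of the action at time `k + 1`, given the state-action pairs up to time `k` and the
state at time `k + 1`. -/
noncomputable def Strategy.actionKernel (γ : M.Strategy) (k : ℕ) :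
    Kernel ((Finset.Iic k → Fin n × A) × Fin n) A where
  toFun p := γ.law (k + 1) (nextHistory k p)
  measurable' := (measurable_of_countable (γ.law (k + 1))).comp (measurable_nextHistory k)

instance (γ : M.Strategy) (k : ℕ) : IsMarkovKernel (γ.actionKernel k) where
  isProbabilityMeasure _ := γ.isProb _ _

/-- The law of the pair (state, action) at time `k + 1`, given the pairs up to time `k`: the state
is drawn from the transition probabilities, then the action from the strategy. -/
noncomputable def Strategy.stepKernel (γ : M.Strategy) (k : ℕ) :
    Kernel (Finset.Iic k → Fin n × A) (Fin n × A) :=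
  (M.stateKernel.comap (fun h => h ⟨k, Finset.mem_Iic.2 le_rfl⟩) (measurable_pi_apply _)) ⊗ₖ
    γ.actionKernel k

instance (γ : M.Strategy) (k : ℕ) : IsMarkovKernel (γ.stepKernel k) := by
  unfold Strategy.stepKernel
  infer_instance

/-- The law of the pair (state, action) at time `0`, for the initial state `i`. -/
noncomputable def Strategy.initialLaw (γ : M.Strategy) (i : Fin n) : Measure (Fin n × A) :=
  (Measure.dirac i).prod (γ.law 0 fun _ => i)

/-- The law of the state-action process `(ξ_k, α_k)_{k ≥ 0}` driven by the strategy `γ`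
from the initial state `i`. -/
noncomputable def Strategy.pathMeasure (γ : M.Strategy) (i : Fin n) :
    Measure (ℕ → Fin n × A) :=
  Kernel.trajMeasure (X := fun _ => Fin n × A) (γ.initialLaw i) γ.stepKernel

/-- The mean reward per time unit
`μ_i^γ = liminf_N (1/N) E^{γ,i}(r_{ξ_0}^{α_0} + ⋯ + r_{ξ_{N-1}}^{α_{N-1}}) ∈ [-∞, +∞]`. -/
noncomputable def Strategy.meanReward (γ : M.Strategy) (i : Fin n) : EReal :=
  liminf (fun N : ℕ => ((1 / (N : ℝ) : ℝ) : EReal) *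
    extMean (γ.pathMeasure i)
      (fun ω => ∑ k ∈ Finset.range N, M.rewardExt (ω k).1 (ω k).2)) atTop

/-- The transition matrix `P^τ_ij = ∫_A P_ij^a dτ_i(a)`. -/
noncomputable def StationaryRule.transMatrix (τ : M.StationaryRule) :
    Matrix (Fin n) (Fin n) ℝ :=
  fun i j => ∫ a, M.transExt i a j ∂(τ.law i)

/-- The vector `r^τ_i = ∫_A r_i^a dτ_i(a) ∈ ℝ ∪ {-∞}`. -/
noncomputable def StationaryRule.meanRewardVector (τ : M.StationaryRule) (i : Fin n) : EReal :=
  extMean (τ.law i) (M.rewardExt i)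

/-- The number `m_F^τ r_F^τ`, where `m_F^τ` is the invariant measure of the `F × F` submatrix
of `P^τ`. -/
noncomputable def StationaryRule.classReward (τ : M.StationaryRule) (F : Finset (Fin n)) : EReal :=
  ∑ i : F, ((invariantMeasureOn τ.transMatrix F i : ℝ) : EReal) * τ.meanRewardVector i

end MarkovControlModel

open scoped Matrix Topology

/-!
For a stationary rule `τ` the Cesàro means of the powers of `P^τ` converge to a projection `Q`, and
the mean reward vector is `g = Q r^τ`. Since `P^τ g = g`, the maximum principle shows that `g` is
maximal on some final class `F`. On a final class the rows of `Q` are all equal to the invariant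
measure, so `g` has there the constant value `m_F r_F`; it is `-∞` as soon as a state with
`r^τ = -∞` is accessible.

Telescoping `u` along the process bounds the mean reward of every strategy by `λ`. On a final class,
`λ - m_F r_F` is the integral against `m_F > 0` of the slack `λ + u - r^τ - P^τ u ≥ 0`, so it
vanishes exactly when `τ` plays on `F` almost surely actions that are optimal for `u`. For compact
action sets and continuous data, an argument in the style of Danskin's theorem shows that the
subgradients of `f` at `u` are the transition matrices `P^τ` of the rules `τ` that play optimal
actions in every state.
-/

/-! ### Cesàro means -/

/-- The Cesàro mean `N⁻¹ (1 + a + ⋯ + a ^ (N - 1))` of the powers of `a`, with the junk value `0`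
at `N = 0`. -/
noncomputable def cesaroMean {R : Type*} [Ring R] [Algebra ℝ R] (a : R) (N : ℕ) : R :=
  (N : ℝ)⁻¹ • ∑ k ∈ Finset.range N, a ^ k

section CesaroMean

variable {R : Type*} [Ring R] [Algebra ℝ R] {a b p : R} {N : ℕ}

theorem mul_cesaroMean_sub_self (a : R) (N : ℕ) :
    a * cesaroMean a N - cesaroMean a N = (N : ℝ)⁻¹ • (a ^ N - 1) := by
  rw [cesaroMean, mul_smul_comm, ← smul_sub, ← mul_geom_sum a N, sub_mul, one_mul]

theorem cesaroMean_mul_sub_self (a : R) (N : ℕ) :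
    cesaroMean a N * a - cesaroMean a N = (N : ℝ)⁻¹ • (a ^ N - 1) := by
  rw [cesaroMean, smul_mul_assoc, ← smul_sub, ← geom_sum_mul a N, mul_sub, mul_one]

theorem cesaroMean_mul_eq_self (h : a * b = b) (hN : N ≠ 0) : cesaroMean a N * b = b := by
  have hpow (k : ℕ) : a ^ k * b = b := by
    induction k with
    | zero => rw [pow_zero, one_mul]
    | succ k ih => rw [pow_succ, mul_assoc, h, ih]
  rw [cesaroMean, smul_mul_assoc, Finset.sum_mul, Finset.sum_congr rfl fun k _ => hpow k,
    Finset.sum_const, Finset.card_range, ← Nat.cast_smul_eq_nsmul ℝ,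
    inv_smul_smul₀ (Nat.cast_ne_zero.2 hN)]

theorem mul_cesaroMean_eq_self (h : b * a = b) (hN : N ≠ 0) : b * cesaroMean a N = b := by
  have hpow (k : ℕ) : b * a ^ k = b := by
    induction k with
    | zero => rw [pow_zero, mul_one]
    | succ k ih => rw [pow_succ, ← mul_assoc, ih, h]
  rw [cesaroMean, mul_smul_comm, Finset.mul_sum, Finset.sum_congr rfl fun k _ => hpow k,
    Finset.sum_const, Finset.card_range, ← Nat.cast_smul_eq_nsmul ℝ,
    inv_smul_smul₀ (Nat.cast_ne_zero.2 hN)]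

theorem cesaroMean_mem {S : Submonoid R} (hS : Convex ℝ (S : Set R)) (ha : a ∈ S) (hN : N ≠ 0) :
    cesaroMean a N ∈ S := by
  have hN' : (N : ℝ) ≠ 0 := Nat.cast_ne_zero.2 hN
  rw [cesaroMean, Finset.smul_sum]
  exact hS.sum_mem (fun _ _ => by positivity) (by simp [hN']) fun k _ => pow_mem ha k

variable [TopologicalSpace R]

theorem mapClusterPt_cesaroMean_mul_eq_self [ContinuousMul R] [T2Space R]
    (hp : MapClusterPt p atTop (cesaroMean a)) (h : a * b = b) : p * b = b := by
  obtain ⟨U, hU, hlim⟩ := mapClusterPt_iff_ultrafilter.1 hp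
  refine tendsto_nhds_unique (hlim.mul_const b) (tendsto_const_nhds.congr' ?_)
  filter_upwards [hU (eventually_ne_atTop 0)] with N hN
  exact (cesaroMean_mul_eq_self h hN).symm

theorem mul_mapClusterPt_cesaroMean_eq_self [ContinuousMul R] [T2Space R]
    (hp : MapClusterPt p atTop (cesaroMean a)) (h : b * a = b) : b * p = b := by
  obtain ⟨U, hU, hlim⟩ := mapClusterPt_iff_ultrafilter.1 hp
  refine tendsto_nhds_unique (hlim.const_mul b) (tendsto_const_nhds.congr' ?_)
  filter_upwards [hU (eventually_ne_atTop 0)] with N hN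
  exact (mul_cesaroMean_eq_self h hN).symm

variable [IsTopologicalRing R] [ContinuousSMul ℝ R]

theorem tendsto_inv_smul_pow_sub_one {S : Submonoid R} (hS : IsCompact (S : Set R)) (ha : a ∈ S) :
    Tendsto (fun N : ℕ => (N : ℝ)⁻¹ • (a ^ N - 1)) atTop (𝓝 0) := by
  have hpow : Tendsto (fun N : ℕ => (N : ℝ)⁻¹ • a ^ N) atTop (𝓝 0) :=
    (hS.isVonNBounded ℝ).smul_tendsto_zero (.of_forall fun N => pow_mem ha N)
      tendsto_inv_atTop_nhds_zero_nat
  have hone : Tendsto (fun N : ℕ => (N : ℝ)⁻¹ • (1 : R)) atTop (𝓝 0) := by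
    simpa only [zero_smul] using (tendsto_inv_atTop_nhds_zero_nat (𝕜 := ℝ)).smul_const (1 : R)
  simpa only [smul_sub, sub_zero] using hpow.sub hone

variable [T2Space R]

theorem mul_eq_self_of_mapClusterPt_cesaroMean {S : Submonoid R} (hS : IsCompact (S : Set R))
    (ha : a ∈ S) (hp : MapClusterPt p atTop (cesaroMean a)) : a * p = p ∧ p * a = p := by
  obtain ⟨U, hU, hlim⟩ := mapClusterPt_iff_ultrafilter.1 hp
  have hzero := (tendsto_inv_smul_pow_sub_one hS ha).mono_left hU
  have hleft := (hlim.const_mul a).sub hlim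
  have hright := (hlim.mul_const a).sub hlim
  simp only [mul_cesaroMean_sub_self] at hleft
  simp only [cesaroMean_mul_sub_self] at hright
  exact ⟨sub_eq_zero.1 (tendsto_nhds_unique hleft hzero),
    sub_eq_zero.1 (tendsto_nhds_unique hright hzero)⟩

theorem exists_tendsto_cesaroMean {S : Submonoid R} (hS : IsCompact (S : Set R))
    (hconv : Convex ℝ (S : Set R)) (ha : a ∈ S) :
    ∃ p ∈ S, a * p = p ∧ p * a = p ∧ Tendsto (cesaroMean a) atTop (𝓝 p) := by
  have hmem : ∀ᶠ N in atTop, cesaroMean a N ∈ (S : Set R) :=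
    (eventually_ne_atTop 0).mono fun N hN => cesaroMean_mem hconv ha hN
  obtain ⟨p, hpS, hp⟩ := hS.exists_mapClusterPt_of_frequently hmem.frequently
  obtain ⟨hap, hpa⟩ := mul_eq_self_of_mapClusterPt_cesaroMean hS ha hp
  refine ⟨p, hpS, hap, hpa, hS.tendsto_nhds_of_unique_mapClusterPt hmem fun q _ hq => ?_⟩
  have haq := (mul_eq_self_of_mapClusterPt_cesaroMean hS ha hq).1
  -- The product `p * q` of two cluster points is equal to both of them.
  exact (mapClusterPt_cesaroMean_mul_eq_self hp haq).symm.trans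
    (mul_mapClusterPt_cesaroMean_eq_self hq hpa)

end CesaroMean

/-- The limit of the Cesàro means of the powers of `a`, with a junk value when they diverge. For a
stochastic matrix it is the projection onto the fixed vectors, whose `i`-th row gives the long run
frequencies of the states of the Markov chain started at `i`. -/
noncomputable def cesaroLimit {R : Type*} [Ring R] [Algebra ℝ R] [TopologicalSpace R] (a : R) : R :=
  limUnder atTop (cesaroMean a)

section CesaroLimit

variable {ι : Type*} [Fintype ι] [DecidableEq ι] {P Q : Matrix ι ι ℝ}

theorem isCompact_rowStochastic :
    IsCompact (Matrix.rowStochastic ℝ ι : Set (Matrix ι ι ℝ)) := by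
  have h : (Matrix.rowStochastic ℝ ι : Set (Matrix ι ι ℝ)) =
      Set.univ.pi fun _ => stdSimplex ℝ ι := by
    ext P
    exact Matrix.mem_rowStochastic_iff_sum.trans ⟨fun h i _ => ⟨h.1 i, h.2 i⟩,
      fun h => ⟨fun i => (h i trivial).1, fun i => (h i trivial).2⟩⟩
  rw [h]
  exact isCompact_univ_pi fun _ => isCompact_stdSimplex ℝ ι

theorem mul_apply_pos_of_mem_rowStochastic (hP : P ∈ Matrix.rowStochastic ℝ ι)
    (hQ : Q ∈ Matrix.rowStochastic ℝ ι) {i j l : ι} (hij : 0 < Q i j) (hjl : P j l ≠ 0) :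
    0 < (Q * P) i l := by
  have hjl' : 0 < P j l := (Matrix.nonneg_of_mem_rowStochastic hP).lt_of_ne' hjl
  rw [Matrix.mul_apply]
  exact Finset.sum_pos' (fun k _ => mul_nonneg (Matrix.nonneg_of_mem_rowStochastic hQ)
    (Matrix.nonneg_of_mem_rowStochastic hP)) ⟨j, Finset.mem_univ j, mul_pos hij hjl'⟩

theorem cesaroLimit_spec (hP : P ∈ Matrix.rowStochastic ℝ ι) :
    cesaroLimit P ∈ Matrix.rowStochastic ℝ ι ∧ P * cesaroLimit P = cesaroLimit P ∧
      cesaroLimit P * P = cesaroLimit P ∧ Tendsto (cesaroMean P) atTop (𝓝 (cesaroLimit P)) := by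
  obtain ⟨Q, hQ, hPQ, hQP, hlim⟩ :=
    exists_tendsto_cesaroMean (S := Matrix.rowStochastic ℝ ι) isCompact_rowStochastic
      Matrix.convex_rowStochastic hP
  rw [show cesaroLimit P = Q from hlim.limUnder_eq]
  exact ⟨hQ, hPQ, hQP, hlim⟩

theorem cesaroLimit_mem_rowStochastic (hP : P ∈ Matrix.rowStochastic ℝ ι) :
    cesaroLimit P ∈ Matrix.rowStochastic ℝ ι :=
  (cesaroLimit_spec hP).1

theorem tendsto_cesaroMean_cesaroLimit (hP : P ∈ Matrix.rowStochastic ℝ ι) :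
    Tendsto (cesaroMean P) atTop (𝓝 (cesaroLimit P)) :=
  (cesaroLimit_spec hP).2.2.2

theorem mulVec_cesaroLimit_mulVec (hP : P ∈ Matrix.rowStochastic ℝ ι) (g : ι → ℝ) :
    P *ᵥ (cesaroLimit P *ᵥ g) = cesaroLimit P *ᵥ g := by
  rw [Matrix.mulVec_mulVec, (cesaroLimit_spec hP).2.1]

theorem cesaroLimit_mulVec_mulVec (hP : P ∈ Matrix.rowStochastic ℝ ι) (g : ι → ℝ) :
    cesaroLimit P *ᵥ (P *ᵥ g) = cesaroLimit P *ᵥ g := by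
  rw [Matrix.mulVec_mulVec, (cesaroLimit_spec hP).2.2.1]

theorem mul_cesaroLimit_eq_self (hP : P ∈ Matrix.rowStochastic ℝ ι) (h : Q * P = Q) :
    Q * cesaroLimit P = Q :=
  mul_mapClusterPt_cesaroMean_eq_self (tendsto_cesaroMean_cesaroLimit hP).mapClusterPt h

theorem vecMul_cesaroLimit_eq_self (hP : P ∈ Matrix.rowStochastic ℝ ι) {m : ι → ℝ}
    (h : m ᵥ* P = m) : m ᵥ* cesaroLimit P = m := by
  rcases isEmpty_or_nonempty ι with hι | ⟨⟨i⟩⟩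
  · exact Subsingleton.elim _ _
  · have hrow : Matrix.of (fun _ : ι => m) * P = Matrix.of fun _ => m := funext fun _ => h
    exact congrFun (mul_cesaroLimit_eq_self hP hrow) i

end CesaroLimit

/-! ### Final classes and invariant measures -/

section Access

variable {n : ℕ} {P Q : Matrix (Fin n) (Fin n) ℝ} {F : Finset (Fin n)} {i j : Fin n}

theorem hasAccess_of_pow_apply_ne_zero {k : ℕ} (h : (P ^ k) i j ≠ 0) : HasAccess P i j := by
  induction k generalizing j with
  | zero =>
    obtain rfl : i = j := by
      by_contra hij
      exact h (by rw [pow_zero, Matrix.one_apply_ne hij])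
    exact .refl
  | succ k ih =>
    rw [pow_succ, Matrix.mul_apply] at h
    obtain ⟨l, -, hl⟩ := Finset.exists_ne_zero_of_sum_ne_zero h
    exact (ih (left_ne_zero_of_mul hl)).tail (right_ne_zero_of_mul hl)

theorem HasAccess.exists_pow_apply_pos (hP : P ∈ Matrix.rowStochastic ℝ (Fin n))
    (h : HasAccess P i j) : ∃ k, 0 < (P ^ k) i j := by
  induction h with
  | refl => exact ⟨0, by simp⟩
  | tail _ hbc ih =>
    obtain ⟨k, hk⟩ := ih
    refine ⟨k + 1, ?_⟩
    rw [pow_succ]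
    exact mul_apply_pos_of_mem_rowStochastic hP (pow_mem hP k) hk hbc

theorem HasAccess.of_row_eq (hF : ∀ i ∈ F, ∀ j, P i j ≠ 0 → j ∈ F) (hrow : ∀ i ∈ F, Q i = P i)
    (hi : i ∈ F) (h : HasAccess P i j) : HasAccess Q i j := by
  suffices HasAccess Q i j ∧ j ∈ F from this.1
  induction h with
  | refl => exact ⟨.refl, hi⟩
  | tail _ hbc ih => exact ⟨ih.1.tail (by rwa [hrow _ ih.2]), hF _ ih.2 _ hbc⟩

theorem isFinalClass_iff :
    IsFinalClass P F ↔ F.Nonempty ∧ ∀ i ∈ F, ∀ j, j ∈ F ↔ HasAccess P i j := by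
  constructor
  · rintro ⟨⟨k, hk⟩, hF⟩
    exact ⟨⟨k, (hk k).2 ⟨.refl, .refl⟩⟩, fun i hi j =>
      ⟨fun hj => ((hk i).1 hi).2.trans ((hk j).1 hj).1, hF i hi j⟩⟩
  · rintro ⟨⟨k, hk⟩, hF⟩
    exact ⟨⟨k, fun j => ⟨fun hj => ⟨(hF k hk j).1 hj, (hF j hj k).1 hk⟩,
      fun hj => (hF k hk j).2 hj.1⟩⟩, fun i hi j => (hF i hi j).2⟩

theorem IsFinalClass.nonempty (hF : IsFinalClass P F) : F.Nonempty :=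
  (isFinalClass_iff.1 hF).1

theorem IsFinalClass.mem_iff_hasAccess (hF : IsFinalClass P F) (hi : i ∈ F) :
    j ∈ F ↔ HasAccess P i j :=
  (isFinalClass_iff.1 hF).2 i hi j

theorem IsFinalClass.apply_eq_zero (hF : IsFinalClass P F) (hi : i ∈ F) (hj : j ∉ F) :
    P i j = 0 :=
  not_not.1 fun h => hj ((hF.mem_iff_hasAccess hi).2 (.single h))

theorem IsFinalClass.of_row_eq (hF : IsFinalClass P F) (hrow : ∀ i ∈ F, Q i = P i) :
    IsFinalClass Q F := by
  have hPclosed : ∀ i ∈ F, ∀ j, P i j ≠ 0 → j ∈ F := fun i hi j h =>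
    (hF.mem_iff_hasAccess hi).2 (.single h)
  have hQclosed : ∀ i ∈ F, ∀ j, Q i j ≠ 0 → j ∈ F := fun i hi j h =>
    hPclosed i hi j (by rwa [← hrow i hi])
  refine isFinalClass_iff.2 ⟨hF.nonempty, fun i hi j => (hF.mem_iff_hasAccess hi).trans ⟨?_, ?_⟩⟩
  · exact .of_row_eq hPclosed hrow hi
  · exact .of_row_eq hQclosed (fun i hi => (hrow i hi).symm) hi

theorem exists_isFinalClass_hasAccess (P : Matrix (Fin n) (Fin n) ℝ) (i : Fin n) :
    ∃ F, IsFinalClass P F ∧ ∀ j ∈ F, HasAccess P i j := by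
  classical
  obtain ⟨j, hij, hmin⟩ := exists_minimalFor_of_wellFoundedLT (HasAccess P i)
    (fun j => {k | HasAccess P j k}) ⟨i, .refl⟩
  have hback {k : Fin n} (hjk : HasAccess P j k) : HasAccess P k j :=
    hmin (hij.trans hjk) (fun l hl => hjk.trans hl) .refl
  have hmem (k : Fin n) : k ∈ {k | HasAccess P j k}.toFinset ↔ HasAccess P j k := Set.mem_toFinset
  refine ⟨{k | HasAccess P j k}.toFinset, isFinalClass_iff.2 ⟨⟨j, (hmem j).2 .refl⟩, ?_⟩, ?_⟩
  · intro k hk l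
    rw [hmem] at hk ⊢
    exact ⟨(hback hk).trans, hk.trans⟩
  · exact fun k hk => hij.trans ((hmem k).1 hk)

theorem cesaroLimit_apply_eq_zero (hP : P ∈ Matrix.rowStochastic ℝ (Fin n))
    (h : ¬ HasAccess P i j) : cesaroLimit P i j = 0 := by
  have hzero (N : ℕ) : cesaroMean P N i j = 0 := by
    rw [cesaroMean, Matrix.smul_apply, Matrix.sum_apply, Finset.sum_eq_zero, smul_zero]
    exact fun k _ => not_not.1 fun hk => h (hasAccess_of_pow_apply_ne_zero hk)
  have hlim := ((tendsto_cesaroMean_cesaroLimit hP).apply_nhds i).apply_nhds j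
  exact tendsto_nhds_unique hlim (by simp only [hzero, tendsto_const_nhds])

end Access

section MaximumPrinciple

variable {n : ℕ} {P : Matrix (Fin n) (Fin n) ℝ} {F : Finset (Fin n)} {g : Fin n → ℝ} {i j : Fin n}

theorem HasAccess.eq_of_forall_le (hP : P ∈ Matrix.rowStochastic ℝ (Fin n)) (hg : P *ᵥ g = g)
    (hmax : ∀ k, HasAccess P i k → g k ≤ g i) (hij : HasAccess P i j) : g j = g i := by
  induction hij with
  | refl => rfl
  | @tail b c hib hbc ih =>
    have hle (k : Fin n) : P b k * g k ≤ P b k * g i := by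
      by_cases hk : P b k = 0
      · rw [hk, zero_mul, zero_mul]
      · exact mul_le_mul_of_nonneg_left (hmax k (hib.tail hk))
          (Matrix.nonneg_of_mem_rowStochastic hP)
    have hsum : ∑ k, P b k * g k = ∑ k, P b k * g i := by
      rw [← Finset.sum_mul, Matrix.sum_row_of_mem_rowStochastic hP, one_mul, ← ih]
      exact congrFun hg b
    exact mul_left_cancel₀ hbc
      ((Finset.sum_eq_sum_iff_of_le fun k _ => hle k).1 hsum c (Finset.mem_univ c))

theorem IsFinalClass.eq_of_mulVec_eq_self (hF : IsFinalClass P F)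
    (hP : P ∈ Matrix.rowStochastic ℝ (Fin n)) (hg : P *ᵥ g = g) (hi : i ∈ F) (hj : j ∈ F) :
    g i = g j := by
  obtain ⟨k, hk, hmax⟩ := F.exists_max_image g hF.nonempty
  have heq {l : Fin n} (hl : l ∈ F) : g l = g k :=
    ((hF.mem_iff_hasAccess hk).1 hl).eq_of_forall_le hP hg fun l hl =>
      hmax l ((hF.mem_iff_hasAccess hk).2 hl)
  rw [heq hi, heq hj]

theorem exists_isFinalClass_forall_le (hP : P ∈ Matrix.rowStochastic ℝ (Fin n)) (hg : P *ᵥ g = g)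
    (i : Fin n) : ∃ F, IsFinalClass P F ∧ ∀ j ∈ F, HasAccess P i j ∧ g i ≤ g j := by
  obtain ⟨k, hik, hmax⟩ :=
    Set.exists_max_image {j | HasAccess P i j} g (Set.toFinite _) ⟨i, .refl⟩
  obtain ⟨F, hF, hkF⟩ := exists_isFinalClass_hasAccess P k
  refine ⟨F, hF, fun j hj => ⟨hik.trans (hkF j hj), ?_⟩⟩
  rw [(hkF j hj).eq_of_forall_le hP hg fun l hl => hmax l (hik.trans hl)]
  exact hmax i .refl

end MaximumPrinciple

section InvariantMeasure

theorem extend_val_zero_vecMul {ι κ : Type*} [Fintype ι] {s : Finset ι} (m : s → ℝ)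
    (M : Matrix ι κ ℝ) (j : κ) :
    (Function.extend Subtype.val m 0 ᵥ* M) j = ∑ i : s, m i * M i j := by
  refine (Fintype.sum_of_injective Subtype.val Subtype.val_injective _ _ (fun i hi => ?_)
    fun i => ?_).symm
  · rw [Function.extend_apply' _ _ _ hi, Pi.zero_apply, zero_mul]
  · rw [Subtype.val_injective.extend_apply]

variable {n : ℕ} {P : Matrix (Fin n) (Fin n) ℝ} {F : Finset (Fin n)} {i j : Fin n}

namespace IsFinalClass

theorem cesaroLimit_apply_eq_zero (hF : IsFinalClass P F) (hP : P ∈ Matrix.rowStochastic ℝ (Fin n))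
    (hi : i ∈ F) (hj : j ∉ F) : cesaroLimit P i j = 0 :=
  _root_.cesaroLimit_apply_eq_zero hP (mt (hF.mem_iff_hasAccess hi).2 hj)

theorem cesaroLimit_apply_congr (hF : IsFinalClass P F) (hP : P ∈ Matrix.rowStochastic ℝ (Fin n))
    (hi : i ∈ F) (hj : j ∈ F) (k : Fin n) : cesaroLimit P i k = cesaroLimit P j k := by
  have h := hF.eq_of_mulVec_eq_self hP (mulVec_cesaroLimit_mulVec hP (Pi.single k 1)) hi hj
  rwa [Matrix.mulVec_single_one] at h

theorem cesaroLimit_apply_pos (hF : IsFinalClass P F) (hP : P ∈ Matrix.rowStochastic ℝ (Fin n))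
    (hi : i ∈ F) (hj : j ∈ F) : 0 < cesaroLimit P i j := by
  have hQ := cesaroLimit_mem_rowStochastic hP
  obtain ⟨k, -, hk⟩ := Finset.exists_ne_zero_of_sum_ne_zero
    ((Matrix.sum_row_of_mem_rowStochastic hQ i).trans_ne one_ne_zero)
  have hkF : k ∈ F := not_not.1 fun h => hk (hF.cesaroLimit_apply_eq_zero hP hi h)
  have hkj : HasAccess P k j := (hF.mem_iff_hasAccess hkF).1 hj
  induction hkj with
  | refl => exact (Matrix.nonneg_of_mem_rowStochastic hQ).lt_of_ne' hk
  | tail hkb hbc ih =>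
    rw [← (cesaroLimit_spec hP).2.2.1]
    exact mul_apply_pos_of_mem_rowStochastic hP hQ (ih ((hF.mem_iff_hasAccess hkF).2 hkb)) hbc

theorem sum_cesaroLimit_mul (hF : IsFinalClass P F) (hP : P ∈ Matrix.rowStochastic ℝ (Fin n))
    (hi : i ∈ F) (g : Fin n → ℝ) :
    ∑ j : F, cesaroLimit P i j * g j = (cesaroLimit P *ᵥ g) i := by
  rw [Finset.sum_coe_sort F fun j => cesaroLimit P i j * g j]
  refine Finset.sum_subset F.subset_univ fun j _ hj => ?_
  rw [hF.cesaroLimit_apply_eq_zero hP hi hj, zero_mul]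

theorem isInvariantMeasureOn_cesaroLimit (hF : IsFinalClass P F)
    (hP : P ∈ Matrix.rowStochastic ℝ (Fin n)) (hi : i ∈ F) :
    IsInvariantMeasureOn P F fun j => cesaroLimit P i j := by
  have hQ := cesaroLimit_mem_rowStochastic hP
  refine ⟨⟨fun j => Matrix.nonneg_of_mem_rowStochastic hQ, ?_⟩, funext fun j => ?_⟩
  · have hone := hF.sum_cesaroLimit_mul hP hi 1
    rw [Matrix.one_vecMul_of_mem_rowStochastic hQ] at hone
    simpa only [Pi.one_apply, mul_one] using hone
  · calc ∑ k : F, cesaroLimit P i k * P k j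
        = (cesaroLimit P * P) i j := hF.sum_cesaroLimit_mul hP hi fun k => P k j
      _ = cesaroLimit P i j := by rw [(cesaroLimit_spec hP).2.2.1]

theorem extend_vecMul_eq_self (hF : IsFinalClass P F) {m : F → ℝ}
    (hm : IsInvariantMeasureOn P F m) :
    Function.extend Subtype.val m 0 ᵥ* P = Function.extend Subtype.val m 0 := by
  funext j
  rw [extend_val_zero_vecMul]
  by_cases hj : j ∈ F
  · exact (congrFun hm.2 ⟨j, hj⟩).trans (Subtype.val_injective.extend_apply m 0 ⟨j, hj⟩).symm
  · rw [Function.extend_apply' _ _ _ (by rintro ⟨k, rfl⟩; exact hj k.2), Pi.zero_apply]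
    exact Finset.sum_eq_zero fun k _ => by rw [hF.apply_eq_zero k.2 hj, mul_zero]

theorem isInvariantMeasureOn_iff (hF : IsFinalClass P F)
    (hP : P ∈ Matrix.rowStochastic ℝ (Fin n)) (hi : i ∈ F) {m : F → ℝ} :
    IsInvariantMeasureOn P F m ↔ m = fun j : F => cesaroLimit P i j := by
  refine ⟨fun hm => funext fun j => ?_, ?_⟩
  · have hfix := vecMul_cesaroLimit_eq_self hP (hF.extend_vecMul_eq_self hm)
    calc m j = Function.extend Subtype.val m 0 (j : Fin n) :=
          (Subtype.val_injective.extend_apply m 0 j).symm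
      _ = (Function.extend Subtype.val m 0 ᵥ* cesaroLimit P) j := by rw [hfix]
      _ = ∑ k : F, m k * cesaroLimit P i j := by
          rw [extend_val_zero_vecMul]
          exact Finset.sum_congr rfl fun k _ => by rw [hF.cesaroLimit_apply_congr hP hi k.2]
      _ = cesaroLimit P i j := by rw [← Finset.sum_mul, hm.1.2, one_mul]
  · rintro rfl
    exact hF.isInvariantMeasureOn_cesaroLimit hP hi

theorem existsUnique_isInvariantMeasureOn (hF : IsFinalClass P F)
    (hP : P ∈ Matrix.rowStochastic ℝ (Fin n)) : ∃! m, IsInvariantMeasureOn P F m := by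
  obtain ⟨i, hi⟩ := hF.nonempty
  simp only [hF.isInvariantMeasureOn_iff hP hi, existsUnique_eq]

theorem invariantMeasureOn_apply (hF : IsFinalClass P F)
    (hP : P ∈ Matrix.rowStochastic ℝ (Fin n)) (hi : i ∈ F) (j : F) :
    invariantMeasureOn P F j = cesaroLimit P i j := by
  have hex : ∃ m, IsInvariantMeasureOn P F m := ⟨_, hF.isInvariantMeasureOn_cesaroLimit hP hi⟩
  rw [invariantMeasureOn, dif_pos hex, (hF.isInvariantMeasureOn_iff hP hi).1 hex.choose_spec]

theorem cesaroLimit_mulVec_apply_eq_iff (hF : IsFinalClass P F)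
    (hP : P ∈ Matrix.rowStochastic ℝ (Fin n)) (hi : i ∈ F) {R u : Fin n → ℝ} {lam : ℝ}
    (hle : ∀ j ∈ F, R j + (P *ᵥ u) j ≤ lam + u j) :
    (cesaroLimit P *ᵥ R) i = lam ↔ ∀ j ∈ F, R j + (P *ᵥ u) j = lam + u j := by
  -- Integrate the slack `lam + u - R - P u ≥ 0` against row `i` of `cesaroLimit P`, which is
  -- invariant under `P` and positive on `F`.
  have hslack : lam - (cesaroLimit P *ᵥ R) i =
      ∑ j : F, cesaroLimit P i j * (lam + u j - (R j + (P *ᵥ u) j)) := by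
    have hQ := cesaroLimit_mem_rowStochastic hP
    rw [hF.sum_cesaroLimit_mul hP hi fun j => lam + u j - (R j + (P *ᵥ u) j)]
    have hvec : (fun j => lam + u j - (R j + (P *ᵥ u) j)) = lam • 1 + u - (R + P *ᵥ u) := by
      ext j; simp
    rw [hvec, Matrix.mulVec_sub, Matrix.mulVec_add, Matrix.mulVec_add, Matrix.mulVec_smul,
      cesaroLimit_mulVec_mulVec hP, Matrix.one_vecMul_of_mem_rowStochastic hQ]
    simp
  have hnonneg (j : F) : 0 ≤ cesaroLimit P i j * (lam + u j - (R j + (P *ᵥ u) j)) :=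
    mul_nonneg (hF.cesaroLimit_apply_pos hP hi j.2).le (sub_nonneg.2 (hle j j.2))
  rw [eq_comm, ← sub_eq_zero, hslack, Finset.sum_eq_zero_iff_of_nonneg fun j _ => hnonneg j]
  simp only [Finset.mem_univ, forall_const, mul_eq_zero, Subtype.forall]
  refine forall₂_congr fun j hj => ?_
  rw [or_iff_right (hF.cesaroLimit_apply_pos hP hi hj).ne', sub_eq_zero, eq_comm]

end IsFinalClass

end InvariantMeasure

/-! ### The state-action process -/

section TrajMeasure

variable {E : Type*} [MeasurableSpace E] (μ₀ : Measure E)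
  (κ : (k : ℕ) → Kernel (Finset.Iic k → E) E) [∀ k, IsMarkovKernel (κ k)]

theorem map_eval_zero_trajMeasure :
    (Kernel.trajMeasure (X := fun _ => E) μ₀ κ).map (fun x => x 0) = μ₀ := by
  let e := MeasurableEquiv.piUnique (fun _ : Finset.Iic 0 => E)
  have hmap : (Kernel.trajMeasure (X := fun _ => E) μ₀ κ).map (Preorder.frestrictLe 0) =
      μ₀.map e.symm := by
    rw [Kernel.trajMeasure, Measure.map_comp _ _ (by fun_prop), Kernel.traj_map_frestrictLe,
      Kernel.partialTraj_self, Measure.id_comp]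
  have hrestr : Measurable (Preorder.frestrictLe (π := fun _ : ℕ => E) 0) := by fun_prop
  have heval : (fun x : ℕ → E => x 0) = e ∘ Preorder.frestrictLe 0 := rfl
  rw [heval, ← Measure.map_map e.measurable hrestr, hmap, e.map_map_symm]

theorem map_eval_succ_trajMeasure [IsProbabilityMeasure μ₀] (k : ℕ) :
    (Kernel.trajMeasure (X := fun _ => E) μ₀ κ).map (fun x => x (k + 1)) =
      κ k ∘ₘ (Kernel.trajMeasure (X := fun _ => E) μ₀ κ).map (Preorder.frestrictLe k) := by
  rw [← Measure.snd_compProd, Kernel.map_frestrictLe_trajMeasure_compProd_eq_map_trajMeasure,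
    Measure.snd, Measure.map_map measurable_snd (by fun_prop)]
  rfl

end TrajMeasure

section ExtMean

variable {Ω : Type*} [MeasurableSpace Ω] {μ : Measure Ω}

theorem extMean_of_integrable {f : Ω → ℝ} (hf : Integrable f μ) :
    extMean μ f = ((∫ ω, f ω ∂μ : ℝ) : EReal) := by
  rw [extMean, integral_eq_lintegral_pos_part_sub_lintegral_neg_part hf, EReal.coe_sub,
    EReal.coe_ennreal_toReal hf.lintegral_lt_top.ne,
    EReal.coe_ennreal_toReal (x := ∫⁻ ω, ENNReal.ofReal (-f ω) ∂μ) hf.neg.lintegral_lt_top.ne]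

theorem lintegral_ofReal_neg_eq_top {f b : Ω → ℝ} (hfm : AEStronglyMeasurable f μ)
    (hf : ¬Integrable f μ) (hb : Integrable b μ) (hfb : f ≤ᵐ[μ] b) :
    ∫⁻ ω, ENNReal.ofReal (-f ω) ∂μ = ⊤ := by
  by_contra htop
  have hneg : Integrable (fun ω => max (-f ω) 0) μ := by
    have hmeas : AEStronglyMeasurable (fun ω => max (-f ω) 0) μ :=
      hfm.neg.sup aestronglyMeasurable_const
    refine (lintegral_ofReal_ne_top_iff_integrable hmeas
      (ae_of_all _ fun ω => le_max_right _ _)).1 ?_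
    simpa using htop
  exact hf (integrable_of_le_of_le hfm
    (ae_of_all _ fun ω => neg_le.1 (le_max_left (-f ω) 0)) hfb hneg.neg hb)

theorem extMean_eq_bot {f b : Ω → ℝ} (hfm : AEStronglyMeasurable f μ) (hf : ¬Integrable f μ)
    (hb : Integrable b μ) (hfb : f ≤ᵐ[μ] b) : extMean μ f = ⊥ := by
  rw [extMean, lintegral_ofReal_neg_eq_top hfm hf hb hfb, EReal.coe_ennreal_top, EReal.sub_top]

theorem extMean_le_integral {f b : Ω → ℝ} (hfm : AEStronglyMeasurable f μ)
    (hb : Integrable b μ) (hfb : f ≤ᵐ[μ] b) : extMean μ f ≤ ((∫ ω, b ω ∂μ : ℝ) : EReal) := by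
  by_cases hf : Integrable f μ
  · rw [extMean_of_integrable hf]
    exact_mod_cast integral_mono_ae hf hb hfb
  · rw [extMean_eq_bot hfm hf hb hfb]
    exact bot_le

theorem integrable_of_integrable_sum {ι : Type*} {s : Finset ι} {f b : ι → Ω → ℝ} {i : ι}
    (hi : i ∈ s) (hfm : AEStronglyMeasurable (f i) μ) (hb : ∀ j ∈ s, Integrable (b j) μ)
    (hfb : ∀ j ∈ s, f j ≤ᵐ[μ] b j) (hsum : Integrable (fun ω => ∑ j ∈ s, f j ω) μ) :
    Integrable (f i) μ := by
  classical
  refine integrable_of_le_of_le hfm (g₁ := fun ω => ∑ j ∈ s, f j ω - ∑ j ∈ s.erase i, b j ω)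
    ?_ (hfb i hi)
    (hsum.sub (integrable_finsetSum _ fun j hj => hb j (Finset.mem_of_mem_erase hj))) (hb i hi)
  filter_upwards [(Finset.eventually_all s).2 hfb] with ω hω
  rw [← Finset.add_sum_erase s (fun j => f j ω) hi, sub_le_iff_le_add]
  gcongr with j hj
  exact hω j (Finset.mem_of_mem_erase hj)

theorem extMean_sum_eq_bot {ι : Type*} {s : Finset ι} {f b : ι → Ω → ℝ} {i : ι}
    (hi : i ∈ s) (hf : ¬Integrable (f i) μ) (hfm : ∀ j ∈ s, AEStronglyMeasurable (f j) μ)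
    (hb : ∀ j ∈ s, Integrable (b j) μ) (hfb : ∀ j ∈ s, f j ≤ᵐ[μ] b j) :
    extMean μ (fun ω => ∑ j ∈ s, f j ω) = ⊥ := by
  refine extMean_eq_bot (Finset.aestronglyMeasurable_fun_sum _ hfm)
    (fun hsum => hf (integrable_of_integrable_sum hi (hfm i hi) hb hfb hsum))
    (integrable_finsetSum s hb) ?_
  filter_upwards [(Finset.eventually_all s).2 hfb] with ω hω using Finset.sum_le_sum hω

end ExtMean

theorem ereal_coe_finsetSum {ι : Type*} (s : Finset ι) (f : ι → ℝ) :
    ((∑ i ∈ s, f i : ℝ) : EReal) = ∑ i ∈ s, (f i : EReal) :=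
  map_sum (⟨⟨Real.toEReal, EReal.coe_zero⟩, EReal.coe_add⟩ : ℝ →+ EReal) f s

namespace MarkovControlModel

variable {n : ℕ} {A : Type*} [TopologicalSpace A] [MeasurableSpace A] [BorelSpace A]
  {M : MarkovControlModel n A}

instance (γ : M.Strategy) (k : ℕ) (h : Finset.Iic k → Fin n) : IsProbabilityMeasure (γ.law k h) :=
  γ.isProb k h

instance (γ : M.Strategy) (i : Fin n) : IsProbabilityMeasure (γ.initialLaw i) := by
  unfold Strategy.initialLaw
  infer_instance

instance (γ : M.Strategy) (i : Fin n) : IsProbabilityMeasure (γ.pathMeasure i) := by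
  unfold Strategy.pathMeasure
  infer_instance

theorem measurable_rewardExt_uncurry (M : MarkovControlModel n A) :
    Measurable fun p : Fin n × A => M.rewardExt p.1 p.2 := by
  classical
  exact measurable_from_prod_countable_right fun i =>
    Measurable.dite (M.measurable_reward i) measurable_const (M.measurableSet_act i)

theorem measurable_rewardExt (M : MarkovControlModel n A) (i : Fin n) :
    Measurable (M.rewardExt i) :=
  M.measurable_rewardExt_uncurry.comp measurable_prodMk_left

theorem measurable_transExt_dotProduct (M : MarkovControlModel n A) (u : Fin n → ℝ) :
    Measurable fun p : Fin n × A => M.transExt p.1 p.2 ⬝ᵥ u :=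
  Finset.measurable_sum _ fun j _ =>
    (measurable_from_prod_countable_right fun i => M.measurable_transExt i j).mul_const _

theorem transExt_mem_stdSimplex (M : MarkovControlModel n A) (i : Fin n) (a : A) :
    M.transExt i a ∈ stdSimplex ℝ (Fin n) :=
  ⟨M.transExt_nonneg i a, M.sum_transExt i a⟩

theorem measurableSet_setOf_mem_act (M : MarkovControlModel n A) :
    MeasurableSet {p : Fin n × A | p.2 ∈ M.act p.1} := by
  have h : {p : Fin n × A | p.2 ∈ M.act p.1} = ⋃ i, {i} ×ˢ M.act i := by
    ext ⟨i, a⟩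
    simp
  rw [h]
  exact .iUnion fun i => (measurableSet_singleton i).prod (M.measurableSet_act i)

theorem integral_stateKernel (M : MarkovControlModel n A) (p : Fin n × A) (u : Fin n → ℝ) :
    ∫ j, u j ∂M.stateKernel p = M.transExt p.1 p.2 ⬝ᵥ u := by
  change ∫ j, u j ∂(∑ j, ENNReal.ofReal (M.transExt p.1 p.2 j) • Measure.dirac j) = _
  rw [integral_finsetSum_measure fun j _ =>
    (integrable_dirac (by simp)).smul_measure ENNReal.ofReal_ne_top]
  exact Finset.sum_congr rfl fun j _ => by
    rw [integral_smul_measure, integral_dirac, ENNReal.toReal_ofReal (M.transExt_nonneg _ _ j),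
      smul_eq_mul]

namespace Strategy

variable (γ : M.Strategy) (i : Fin n) (k : ℕ)

theorem map_eval_zero_pathMeasure : (γ.pathMeasure i).map (fun ω => ω 0) = γ.initialLaw i :=
  map_eval_zero_trajMeasure _ _

theorem map_eval_succ_pathMeasure : (γ.pathMeasure i).map (fun ω => ω (k + 1)) =
    γ.stepKernel k ∘ₘ (γ.pathMeasure i).map (Preorder.frestrictLe k) :=
  map_eval_succ_trajMeasure _ _ _

theorem law_ae_mem_act (h : Finset.Iic k → Fin n) :
    ∀ᵐ a ∂γ.law k h, a ∈ M.act (h ⟨k, Finset.mem_Iic.2 le_rfl⟩) :=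
  (prob_compl_eq_zero_iff (M.measurableSet_act _)).2 (γ.law_act k h)

theorem actionKernel_ae_mem_act (h : Finset.Iic k → Fin n × A) (j : Fin n) :
    ∀ᵐ a ∂γ.actionKernel k (h, j), a ∈ M.act j := by
  have hj := γ.law_ae_mem_act (k + 1) (nextHistory k (h, j))
  rwa [show nextHistory k (h, j) ⟨k + 1, Finset.mem_Iic.2 le_rfl⟩ = j by simp [nextHistory]] at hj

theorem ae_mem_act : ∀ᵐ ω ∂γ.pathMeasure i, (ω k).2 ∈ M.act (ω k).1 := by
  have heval : Measurable fun ω : ℕ → Fin n × A => ω k := measurable_pi_apply k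
  refine ae_of_ae_map (p := fun q : Fin n × A => q.2 ∈ M.act q.1) heval.aemeasurable ?_
  cases k with
  | zero =>
    rw [map_eval_zero_pathMeasure, initialLaw,
      Measure.ae_prod_iff_ae_ae M.measurableSet_setOf_mem_act]
    simpa only [ae_dirac_eq, eventually_pure] using γ.law_ae_mem_act 0 fun _ => i
  | succ k =>
    rw [map_eval_succ_pathMeasure]
    refine Measure.ae_comp_of_ae_ae M.measurableSet_setOf_mem_act (ae_of_all _ fun h => ?_)
    rw [stepKernel, Kernel.ae_compProd_iff M.measurableSet_setOf_mem_act]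
    exact ae_of_all _ fun j => γ.actionKernel_ae_mem_act k h j

theorem fst_stepKernel : (γ.stepKernel k).fst =
    M.stateKernel.comap (fun h => h ⟨k, Finset.mem_Iic.2 le_rfl⟩) (measurable_pi_apply _) :=
  Kernel.fst_compProd _ _

theorem integrable_state (u : Fin n → ℝ) :
    Integrable (fun ω : ℕ → Fin n × A => u (ω k).1) (γ.pathMeasure i) := by
  have hstate : Measurable fun ω : ℕ → Fin n × A => (ω k).1 :=
    measurable_fst.comp (measurable_pi_apply k)
  exact (Integrable.of_finite (μ := (γ.pathMeasure i).map _) (f := u)).comp_measurable hstate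

theorem integral_state_succ (u : Fin n → ℝ) : ∫ ω, u (ω (k + 1)).1 ∂γ.pathMeasure i =
    ∫ ω, M.transExt (ω k).1 (ω k).2 ⬝ᵥ u ∂γ.pathMeasure i := by
  have heval : Measurable fun ω : ℕ → Fin n × A => ω (k + 1) := measurable_pi_apply (k + 1)
  have hrestr : Measurable (Preorder.frestrictLe (π := fun _ : ℕ => Fin n × A) k) := by fun_prop
  have hstep (h : Finset.Iic k → Fin n × A) : ∫ q, u q.1 ∂γ.stepKernel k h =
      M.transExt (h ⟨k, Finset.mem_Iic.2 le_rfl⟩).1 (h ⟨k, Finset.mem_Iic.2 le_rfl⟩).2 ⬝ᵥ u := by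
    rw [← integral_map (f := u) (φ := Prod.fst) measurable_fst.aemeasurable
      (measurable_of_countable u).aestronglyMeasurable, ← Kernel.fst_apply, fst_stepKernel,
      Kernel.comap_apply, integral_stateKernel]
  have hu : Integrable (fun q : Fin n × A => u q.1)
      ((γ.pathMeasure i).map fun ω => ω (k + 1)) :=
    (integrable_map_measure ((measurable_of_countable u).comp measurable_fst).aestronglyMeasurable
      heval.aemeasurable).2 (γ.integrable_state i (k + 1) u)
  calc ∫ ω, u (ω (k + 1)).1 ∂γ.pathMeasure i
      = ∫ q, u q.1 ∂(γ.pathMeasure i).map fun ω => ω (k + 1) :=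
        (integral_map heval.aemeasurable hu.aestronglyMeasurable).symm
    _ = ∫ h, ∫ q, u q.1 ∂γ.stepKernel k h ∂(γ.pathMeasure i).map (Preorder.frestrictLe k) := by
        rw [map_eval_succ_pathMeasure, Measure.comp_eq_comp_const_apply] at hu ⊢
        rw [Kernel.integral_comp hu, Kernel.const_apply]
    _ = _ := by
        simp_rw [hstep]
        exact integral_map hrestr.aemeasurable
          ((M.measurable_transExt_dotProduct u).comp (measurable_pi_apply _)).aestronglyMeasurable

end Strategy

theorem reward_add_le_dpOperator (M : MarkovControlModel n A) (x : Fin n → ℝ) {i : Fin n} {a : A}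
    (ha : a ∈ M.act i) : M.rewardExt i a + M.transExt i a ⬝ᵥ x ≤ M.dpOperator x i := by
  obtain ⟨b, hb⟩ := M.attained i x
  simp only [rewardExt, transExt, dif_pos ha]
  exact le_ciSup (f := fun a : M.act i => M.reward i a + ∑ j, M.trans i a j * x j)
    ⟨_, by rintro _ ⟨c, rfl⟩; exact hb c⟩ ⟨a, ha⟩

theorem exists_eq_dpOperator (M : MarkovControlModel n A) (x : Fin n → ℝ) (i : Fin n) :
    ∃ a ∈ M.act i, M.rewardExt i a + M.transExt i a ⬝ᵥ x = M.dpOperator x i := by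
  obtain ⟨b, hb⟩ := M.attained i x
  refine ⟨b, b.2, (M.reward_add_le_dpOperator x b.2).antisymm ?_⟩
  simp only [rewardExt, transExt, dif_pos b.2]
  have : Nonempty (M.act i) := ⟨b⟩
  exact ciSup_le hb

theorem rewardExt_le (M : MarkovControlModel n A) {i : Fin n} {a : A} (ha : a ∈ M.act i) :
    M.rewardExt i a ≤ M.dpOperator 0 i := by
  simpa only [dotProduct_zero, add_zero] using M.reward_add_le_dpOperator 0 ha

theorem integrable_transExt_dotProduct (M : MarkovControlModel n A) {Ω : Type*}
    [MeasurableSpace Ω] {μ : Measure Ω} [IsFiniteMeasure μ] {X : Ω → Fin n × A}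
    (hX : Measurable X) (u : Fin n → ℝ) :
    Integrable (fun ω => M.transExt (X ω).1 (X ω).2 ⬝ᵥ u) μ := by
  refine integrable_finsetSum _ fun j _ => Integrable.mul_const ?_ _
  have hmeas : Measurable fun p : Fin n × A => M.transExt p.1 p.2 j :=
    measurable_from_prod_countable_right fun i => M.measurable_transExt i j
  refine .of_bound (hmeas.comp hX).aestronglyMeasurable 1 (ae_of_all _ fun ω => ?_)
  have hmem := mem_Icc_of_mem_stdSimplex (M.transExt_mem_stdSimplex (X ω).1 (X ω).2) j
  exact (Real.norm_of_nonneg hmem.1).trans_le hmem.2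

namespace Strategy

variable (γ : M.Strategy) (i : Fin n)

theorem aestronglyMeasurable_reward (k : ℕ) :
    AEStronglyMeasurable (fun ω : ℕ → Fin n × A => M.rewardExt (ω k).1 (ω k).2)
      (γ.pathMeasure i) :=
  (M.measurable_rewardExt_uncurry.comp (measurable_pi_apply k)).aestronglyMeasurable

theorem integral_state_zero (u : Fin n → ℝ) : ∫ ω, u (ω 0).1 ∂γ.pathMeasure i = u i := by
  have heval : Measurable fun ω : ℕ → Fin n × A => ω 0 := measurable_pi_apply 0
  have hu : Measurable u := measurable_of_countable u
  rw [← integral_map (f := fun q : Fin n × A => u q.1) heval.aemeasurable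
      (hu.comp measurable_fst).aestronglyMeasurable, map_eval_zero_pathMeasure, initialLaw,
    integral_fun_fst]
  simp

theorem integral_sum_drift (u : Fin n → ℝ) (lam : ℝ) (N : ℕ) :
    ∫ ω, ∑ k ∈ Finset.range N, (lam + u (ω k).1 - M.transExt (ω k).1 (ω k).2 ⬝ᵥ u)
      ∂γ.pathMeasure i = N * lam + u i - ∫ ω, u (ω N).1 ∂γ.pathMeasure i := by
  have htrans (k : ℕ) : Integrable
      (fun ω : ℕ → Fin n × A => M.transExt (ω k).1 (ω k).2 ⬝ᵥ u) (γ.pathMeasure i) :=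
    M.integrable_transExt_dotProduct (measurable_pi_apply k) u
  have hadd (k : ℕ) : Integrable
      (fun ω : ℕ → Fin n × A => lam + u (ω k).1) (γ.pathMeasure i) :=
    (integrable_const lam).add (γ.integrable_state i k u)
  have hdrift (k : ℕ) : ∫ ω, (lam + u (ω k).1 - M.transExt (ω k).1 (ω k).2 ⬝ᵥ u)
      ∂γ.pathMeasure i = lam - (∫ ω, u (ω (k + 1)).1 ∂γ.pathMeasure i -
        ∫ ω, u (ω k).1 ∂γ.pathMeasure i) := by
    rw [integral_sub (hadd k) (htrans k), integral_add (integrable_const _)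
      (γ.integrable_state i k u), integral_const, probReal_univ, one_smul, integral_state_succ]
    ring
  refine (integral_finsetSum _ fun k _ => (hadd k).sub (htrans k)).trans ?_
  simp_rw [Pi.sub_apply, hdrift]
  rw [Finset.sum_sub_distrib, Finset.sum_range_sub fun k => ∫ ω, u (ω k).1 ∂γ.pathMeasure i,
    integral_state_zero, Finset.sum_const, Finset.card_range, nsmul_eq_mul]
  ring

theorem extMean_sum_reward_le {u : Fin n → ℝ} {lam B : ℝ}
    (hu : ∀ j, ∀ a ∈ M.act j, M.rewardExt j a + M.transExt j a ⬝ᵥ u ≤ lam + u j)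
    (hB : ∀ j, B ≤ u j) (N : ℕ) :
    extMean (γ.pathMeasure i) (fun ω => ∑ k ∈ Finset.range N, M.rewardExt (ω k).1 (ω k).2) ≤
      ((N * lam + (u i - B) : ℝ) : EReal) := by
  have hint : Integrable (fun ω : ℕ → Fin n × A => ∑ k ∈ Finset.range N,
      (lam + u (ω k).1 - M.transExt (ω k).1 (ω k).2 ⬝ᵥ u)) (γ.pathMeasure i) :=
    integrable_finsetSum _ fun k _ => ((integrable_const lam).add (γ.integrable_state i k u)).sub
      (M.integrable_transExt_dotProduct (measurable_pi_apply k) u)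
  refine (extMean_le_integral
    (Finset.aestronglyMeasurable_fun_sum _ fun k _ => γ.aestronglyMeasurable_reward i k)
    hint ?_).trans ?_
  · filter_upwards [ae_all_iff.2 (γ.ae_mem_act i)] with ω hω
    exact Finset.sum_le_sum fun k _ => le_sub_iff_add_le.2 (hu _ _ (hω k))
  · have hlast : B ≤ ∫ ω, u (ω N).1 ∂γ.pathMeasure i := by
      simpa using integral_mono (integrable_const B) (γ.integrable_state i N u) fun ω => hB _
    rw [integral_sum_drift, EReal.coe_le_coe_iff]
    linarith

theorem meanReward_le {u : Fin n → ℝ} {lam : ℝ}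
    (hu : ∀ j, ∀ a ∈ M.act j, M.rewardExt j a + M.transExt j a ⬝ᵥ u ≤ lam + u j) :
    γ.meanReward i ≤ lam := by
  obtain ⟨B, hB⟩ := (Set.finite_range u).bddBelow
  have hlim : Tendsto (fun N : ℕ => ((lam + (u i - B) * (1 / (N : ℝ)) : ℝ) : EReal)) atTop
      (𝓝 (lam : EReal)) := by
    refine (continuous_coe_real_ereal.tendsto lam).comp ?_
    simpa using (tendsto_one_div_atTop_nhds_zero_nat (𝕜 := ℝ)).const_mul (u i - B) |>.const_add lam
  rw [← hlim.liminf_eq]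
  refine liminf_le_liminf ?_
  filter_upwards [eventually_ne_atTop 0] with N hN
  have hpos : (0 : EReal) ≤ ((1 / (N : ℝ) : ℝ) : EReal) :=
    EReal.coe_nonneg.2 (by positivity)
  calc _ ≤ ((1 / (N : ℝ) : ℝ) : EReal) * ((N * lam + (u i - B) : ℝ) : EReal) :=
        mul_le_mul_of_nonneg_left
          (γ.extMean_sum_reward_le i hu (fun j => hB ⟨j, rfl⟩) N) hpos
    _ = _ := by
        rw [← EReal.coe_mul]
        congr 1
        field_simp

end Strategy

/-! ### Stationary rules -/

namespace StationaryRule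

variable (τ : M.StationaryRule) (i : Fin n) (k : ℕ)

instance : IsProbabilityMeasure (τ.law i) := τ.isProb i

theorem ae_mem_act : ∀ᵐ a ∂τ.law i, a ∈ M.act i :=
  (prob_compl_eq_zero_iff (M.measurableSet_act i)).2 (τ.law_act i)

theorem integrable_transExt (j : Fin n) : Integrable (fun a => M.transExt i a j) (τ.law i) := by
  simpa only [dotProduct_single_one] using
    M.integrable_transExt_dotProduct (measurable_prodMk_left (x := i)) (Pi.single j 1)

theorem transMatrix_mulVec (x : Fin n → ℝ) :
    (τ.transMatrix *ᵥ x) i = ∫ a, M.transExt i a ⬝ᵥ x ∂τ.law i := by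
  simp only [dotProduct]
  rw [integral_finsetSum _ fun j _ => (τ.integrable_transExt i j).mul_const _]
  simp_rw [integral_mul_const]
  rfl

theorem transMatrix_mem_rowStochastic : τ.transMatrix ∈ Matrix.rowStochastic ℝ (Fin n) := by
  refine ⟨fun i j => integral_nonneg fun a => M.transExt_nonneg i a j, funext fun i => ?_⟩
  simp [transMatrix_mulVec, dotProduct_one, M.sum_transExt]

/-- The family `τ` as a Markov kernel from states to actions. -/
def kernel : Kernel (Fin n) A where
  toFun := τ.law
  measurable' := measurable_of_countable _

instance : IsMarkovKernel τ.kernel := ⟨τ.isProb⟩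

theorem actionKernel_toStrategy : τ.toStrategy.actionKernel k = Kernel.prodMkLeft _ τ.kernel := by
  ext p s
  change τ.law (nextHistory k p _) s = τ.law p.2 s
  simp [nextHistory]

end StationaryRule

/-- The law of the state `ξ_k` under the strategy `γ`, for the initial state `i`. -/
noncomputable def Strategy.stateLaw (γ : M.Strategy) (i : Fin n) (k : ℕ) : Measure (Fin n) :=
  (γ.pathMeasure i).map fun ω => (ω k).1

theorem Strategy.aemeasurable_state (γ : M.Strategy) (i : Fin n) (k : ℕ) :
    AEMeasurable (fun ω => (ω k).1) (γ.pathMeasure i) :=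
  (measurable_fst.comp (measurable_pi_apply k)).aemeasurable

instance (γ : M.Strategy) (i : Fin n) (k : ℕ) : IsProbabilityMeasure (γ.stateLaw i k) :=
  Measure.isProbabilityMeasure_map (γ.aemeasurable_state i k)

namespace StationaryRule

variable (τ : M.StationaryRule) (i : Fin n) (k : ℕ)

theorem map_eval_pathMeasure : (τ.toStrategy.pathMeasure i).map (fun ω => ω k) =
    τ.toStrategy.stateLaw i k ⊗ₘ τ.kernel := by
  suffices h : ∃ ν : Measure (Fin n), SFinite ν ∧
      (τ.toStrategy.pathMeasure i).map (fun ω => ω k) = ν ⊗ₘ τ.kernel by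
    obtain ⟨ν, hν, hmap⟩ := h
    have hfst : τ.toStrategy.stateLaw i k = ν := by
      rw [← Measure.fst_compProd ν τ.kernel, ← hmap, Measure.fst,
        Measure.map_map measurable_fst (measurable_pi_apply k)]
      rfl
    rw [hfst, hmap]
  cases k with
  | zero =>
    refine ⟨Measure.dirac i, inferInstance, ?_⟩
    have hconst : τ.kernel =ᵐ[Measure.dirac i] Kernel.const (Fin n) (τ.law i) := by
      rw [ae_dirac_eq]
      rfl
    rw [Strategy.map_eval_zero_pathMeasure, Measure.compProd_congr hconst, Measure.compProd_const]
    rfl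
  | succ k =>
    refine ⟨M.stateKernel.comap (fun h => h ⟨k, Finset.mem_Iic.2 le_rfl⟩)
      (measurable_pi_apply _) ∘ₘ (τ.toStrategy.pathMeasure i).map (Preorder.frestrictLe k),
      inferInstance, ?_⟩
    rw [Strategy.map_eval_succ_pathMeasure, Strategy.stepKernel, actionKernel_toStrategy,
      Kernel.compProd_prodMkLeft_eq_comp, ← Measure.comp_assoc, Measure.compProd_eq_comp_prod]

theorem integral_state (u : Fin n → ℝ) :
    ∫ ω, u (ω k).1 ∂τ.toStrategy.pathMeasure i = (τ.transMatrix ^ k *ᵥ u) i := by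
  induction k generalizing u with
  | zero => rw [Strategy.integral_state_zero, pow_zero, Matrix.one_mulVec]
  | succ k ih =>
    have hmeas := M.measurable_transExt_dotProduct u
    have hint : Integrable (fun p : Fin n × A => M.transExt p.1 p.2 ⬝ᵥ u)
        (τ.toStrategy.stateLaw i k ⊗ₘ τ.kernel) :=
      M.integrable_transExt_dotProduct measurable_id u
    calc ∫ ω, u (ω (k + 1)).1 ∂τ.toStrategy.pathMeasure i
        = ∫ p, M.transExt p.1 p.2 ⬝ᵥ u ∂(τ.toStrategy.stateLaw i k ⊗ₘ τ.kernel) := by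
          rw [Strategy.integral_state_succ, ← map_eval_pathMeasure,
            integral_map (measurable_pi_apply k).aemeasurable hmeas.aestronglyMeasurable]
      _ = ∫ j, (τ.transMatrix *ᵥ u) j ∂τ.toStrategy.stateLaw i k := by
          simp_rw [transMatrix_mulVec]
          exact Measure.integral_compProd hint
      _ = ∫ ω, (τ.transMatrix *ᵥ u) (ω k).1 ∂τ.toStrategy.pathMeasure i :=
          integral_map (τ.toStrategy.aemeasurable_state i k)
            (measurable_of_countable _).aestronglyMeasurable
      _ = (τ.transMatrix ^ (k + 1) *ᵥ u) i := by rw [ih, Matrix.mulVec_mulVec, pow_succ]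

theorem integral_stateLaw (u : Fin n → ℝ) :
    ∫ j, u j ∂τ.toStrategy.stateLaw i k = (τ.transMatrix ^ k *ᵥ u) i := by
  rw [← integral_state]
  exact integral_map (τ.toStrategy.aemeasurable_state i k)
    (measurable_of_countable _).aestronglyMeasurable

theorem stateLaw_real_singleton (j : Fin n) :
    (τ.toStrategy.stateLaw i k).real {j} = (τ.transMatrix ^ k) i j := by
  rw [← integral_indicator_one (measurableSet_singleton j), integral_stateLaw]
  have : (Set.indicator {j} 1 : Fin n → ℝ) = Pi.single j 1 := by
    ext l; simp [Set.indicator_apply, Pi.single_apply]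
  simp [this]

theorem integrable_reward_iff : Integrable
    (fun ω : ℕ → Fin n × A => M.rewardExt (ω k).1 (ω k).2) (τ.toStrategy.pathMeasure i) ↔
      ∀ j, (τ.transMatrix ^ k) i j ≠ 0 → Integrable (M.rewardExt j) (τ.law j) := by
  have hmeas := M.measurable_rewardExt_uncurry
  have hmap := integrable_map_measure (μ := τ.toStrategy.pathMeasure i) (f := fun ω => ω k)
    hmeas.aestronglyMeasurable (measurable_pi_apply k).aemeasurable
  refine hmap.symm.trans ?_
  rw [map_eval_pathMeasure, Measure.integrable_compProd_iff hmeas.aestronglyMeasurable,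
    and_iff_left Integrable.of_finite, ae_iff_of_countable]
  refine forall_congr' fun j => imp_congr_left ?_
  rw [← stateLaw_real_singleton, Ne, Ne, measureReal_eq_zero_iff]

/-- The number `r^τ_j` as a real; it is the junk value `0` when `r^τ_j = -∞`. -/
noncomputable def expectedReward (j : Fin n) : ℝ :=
  ∫ a, M.rewardExt j a ∂τ.law j

theorem integral_reward {i k} (h : Integrable
    (fun ω : ℕ → Fin n × A => M.rewardExt (ω k).1 (ω k).2) (τ.toStrategy.pathMeasure i)) :
    ∫ ω, M.rewardExt (ω k).1 (ω k).2 ∂τ.toStrategy.pathMeasure i =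
      (τ.transMatrix ^ k *ᵥ τ.expectedReward) i := by
  have hmeas := M.measurable_rewardExt_uncurry.aestronglyMeasurable
    (μ := (τ.toStrategy.pathMeasure i).map fun ω => ω k)
  have heval := (measurable_pi_apply (X := fun _ : ℕ => Fin n × A) k).aemeasurable
    (μ := τ.toStrategy.pathMeasure i)
  have hint := (integrable_map_measure hmeas heval).2 h
  rw [← integral_stateLaw, ← integral_map heval hmeas, map_eval_pathMeasure,
    Measure.integral_compProd (by rwa [← map_eval_pathMeasure])]
  rfl

theorem meanReward_eq_cesaroLimit {i}
    (h : ∀ j, HasAccess τ.transMatrix i j → Integrable (M.rewardExt j) (τ.law j)) :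
    τ.toStrategy.meanReward i =
      ((cesaroLimit τ.transMatrix *ᵥ τ.expectedReward) i : EReal) := by
  have hint (k : ℕ) : Integrable (fun ω : ℕ → Fin n × A => M.rewardExt (ω k).1 (ω k).2)
      (τ.toStrategy.pathMeasure i) :=
    (τ.integrable_reward_iff i k).2 fun j hj => h j (hasAccess_of_pow_apply_ne_zero hj)
  have hmean (N : ℕ) : ((1 / (N : ℝ) : ℝ) : EReal) * extMean (τ.toStrategy.pathMeasure i)
      (fun ω => ∑ k ∈ Finset.range N, M.rewardExt (ω k).1 (ω k).2) =
        ((cesaroMean τ.transMatrix N *ᵥ τ.expectedReward) i : EReal) := by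
    rw [extMean_of_integrable (integrable_finsetSum _ fun k _ => hint k),
      integral_finsetSum _ fun k _ => hint k, ← EReal.coe_mul]
    simp_rw [fun k => τ.integral_reward (hint k)]
    simp [cesaroMean, Matrix.smul_mulVec, Matrix.sum_mulVec]
  have hcont : Continuous fun P : Matrix (Fin n) (Fin n) ℝ =>
      (((P *ᵥ τ.expectedReward) i : ℝ) : EReal) :=
    continuous_coe_real_ereal.comp (by fun_prop)
  rw [Strategy.meanReward, funext hmean]
  exact ((hcont.tendsto _).comp
    (tendsto_cesaroMean_cesaroLimit τ.transMatrix_mem_rowStochastic)).liminf_eq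

theorem meanReward_eq_bot {i j} (hij : HasAccess τ.transMatrix i j)
    (hj : ¬Integrable (M.rewardExt j) (τ.law j)) : τ.toStrategy.meanReward i = ⊥ := by
  obtain ⟨k, hk⟩ := hij.exists_pow_apply_pos τ.transMatrix_mem_rowStochastic
  have hle (l : ℕ) : (fun ω : ℕ → Fin n × A => M.rewardExt (ω l).1 (ω l).2)
      ≤ᵐ[τ.toStrategy.pathMeasure i] fun ω => M.dpOperator 0 (ω l).1 := by
    filter_upwards [τ.toStrategy.ae_mem_act i l] with ω hω using M.rewardExt_le hω
  have hnot := fun h => hj ((τ.integrable_reward_iff i k).1 h j hk.ne')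
  have hev : ∀ᶠ N : ℕ in atTop, ((1 / (N : ℝ) : ℝ) : EReal) *
      extMean (τ.toStrategy.pathMeasure i)
        (fun ω => ∑ k ∈ Finset.range N, M.rewardExt (ω k).1 (ω k).2) = ⊥ := by
    filter_upwards [eventually_gt_atTop k] with N hN
    have hpos : (0 : ℝ) < N := by exact_mod_cast (Nat.zero_le k).trans_lt hN
    rw [extMean_sum_eq_bot (Finset.mem_range.2 hN) hnot
      (fun l _ => τ.toStrategy.aestronglyMeasurable_reward i l)
      (fun l _ => τ.toStrategy.integrable_state i l (M.dpOperator 0)) fun l _ => hle l]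
    exact EReal.coe_mul_bot_of_pos (by positivity)
  rw [Strategy.meanReward, liminf_congr hev, liminf_const]

end StationaryRule

namespace StationaryRule

variable (τ : M.StationaryRule) {F : Finset (Fin n)} {i j : Fin n}

theorem meanRewardVector_eq_expectedReward (h : Integrable (M.rewardExt i) (τ.law i)) :
    τ.meanRewardVector i = τ.expectedReward i :=
  extMean_of_integrable h

theorem meanRewardVector_eq_bot (h : ¬Integrable (M.rewardExt i) (τ.law i)) :
    τ.meanRewardVector i = ⊥ := by
  refine extMean_eq_bot (M.measurable_rewardExt i).aestronglyMeasurable h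
    (integrable_const (M.dpOperator 0 i)) ?_
  filter_upwards [τ.ae_mem_act i] with a ha using M.rewardExt_le ha

theorem classReward_eq_cesaroLimit (hF : IsFinalClass τ.transMatrix F) (hi : i ∈ F)
    (h : ∀ j ∈ F, Integrable (M.rewardExt j) (τ.law j)) :
    τ.classReward F = ((cesaroLimit τ.transMatrix *ᵥ τ.expectedReward) i : EReal) := by
  have hP := τ.transMatrix_mem_rowStochastic
  rw [classReward, ← hF.sum_cesaroLimit_mul hP hi, ereal_coe_finsetSum]
  refine Finset.sum_congr rfl fun j _ => ?_
  rw [τ.meanRewardVector_eq_expectedReward (h j j.2), hF.invariantMeasureOn_apply hP hi,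
    EReal.coe_mul]

theorem classReward_eq_bot (hF : IsFinalClass τ.transMatrix F) (hi : i ∈ F)
    (h : ¬Integrable (M.rewardExt i) (τ.law i)) : τ.classReward F = ⊥ := by
  classical
  have hP := τ.transMatrix_mem_rowStochastic
  have hpos : 0 < invariantMeasureOn τ.transMatrix F ⟨i, hi⟩ := by
    rw [hF.invariantMeasureOn_apply hP hi]
    exact hF.cesaroLimit_apply_pos hP hi hi
  rw [classReward, ← Finset.add_sum_erase _ _ (Finset.mem_univ (⟨i, hi⟩ : F)),
    τ.meanRewardVector_eq_bot h, EReal.coe_mul_bot_of_pos hpos, EReal.bot_add]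

theorem meanReward_eq_classReward (hF : IsFinalClass τ.transMatrix F) (hi : i ∈ F) :
    τ.toStrategy.meanReward i = τ.classReward F := by
  by_cases h : ∀ j ∈ F, Integrable (M.rewardExt j) (τ.law j)
  · rw [τ.classReward_eq_cesaroLimit hF hi h,
      τ.meanReward_eq_cesaroLimit fun j hj => h j ((hF.mem_iff_hasAccess hi).2 hj)]
  · push Not at h
    obtain ⟨j, hj, hint⟩ := h
    rw [τ.classReward_eq_bot hF hj hint,
      τ.meanReward_eq_bot ((hF.mem_iff_hasAccess hi).1 hj) hint]

theorem exists_isFinalClass_meanReward_le (i : Fin n) :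
    ∃ F, IsFinalClass τ.transMatrix F ∧ τ.toStrategy.meanReward i ≤ τ.classReward F := by
  have hP := τ.transMatrix_mem_rowStochastic
  obtain ⟨F, hF, hle⟩ := exists_isFinalClass_forall_le hP
    (mulVec_cesaroLimit_mulVec hP τ.expectedReward) i
  obtain ⟨j, hj⟩ := hF.nonempty
  refine ⟨F, hF, ?_⟩
  by_cases h : ∀ k, HasAccess τ.transMatrix i k → Integrable (M.rewardExt k) (τ.law k)
  · rw [τ.meanReward_eq_cesaroLimit h,
      τ.classReward_eq_cesaroLimit hF hj fun k hk => h k (hle k hk).1]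
    exact_mod_cast (hle j hj).2
  · push Not at h
    obtain ⟨k, hik, hk⟩ := h
    simp only [τ.meanReward_eq_bot hik hk, bot_le]

theorem exists_isGreatest_meanReward_classReward (hn : 0 < n) :
    ∃ v : EReal, IsGreatest (Set.range fun i : Fin n => τ.toStrategy.meanReward i) v ∧
      IsGreatest (τ.classReward '' {F | IsFinalClass τ.transMatrix F}) v := by
  have : Nonempty (Fin n) := ⟨⟨0, hn⟩⟩
  obtain ⟨i, hi⟩ := Finite.exists_max τ.toStrategy.meanReward
  obtain ⟨F, hF, hle⟩ := τ.exists_isFinalClass_meanReward_le i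
  have hub : ∀ G, IsFinalClass τ.transMatrix G →
      τ.classReward G ≤ τ.toStrategy.meanReward i := fun G hG => by
    obtain ⟨j, hj⟩ := hG.nonempty
    exact τ.meanReward_eq_classReward hG hj ▸ hi j
  refine ⟨τ.toStrategy.meanReward i, ⟨⟨i, rfl⟩, ?_⟩, ⟨F, hF, (hub F hF).antisymm hle⟩, ?_⟩
  · rintro _ ⟨j, rfl⟩
    exact hi j
  · rintro _ ⟨G, hG, rfl⟩
    exact hub G hG

end StationaryRule

/-- The actions that attain the supremum defining `f_i(u)`. -/
def optimalActions (M : MarkovControlModel n A) (u : Fin n → ℝ) (i : Fin n) : Set A :=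
  {a ∈ M.act i | M.rewardExt i a + M.transExt i a ⬝ᵥ u = M.dpOperator u i}

theorem measurableSet_optimalActions (M : MarkovControlModel n A) (u : Fin n → ℝ) (i : Fin n) :
    MeasurableSet (M.optimalActions u i) :=
  (M.measurableSet_act i).inter <| measurableSet_eq_fun
    ((M.measurable_rewardExt i).add
      ((M.measurable_transExt_dotProduct u).comp measurable_prodMk_left))
    measurable_const

theorem transExt_dotProduct_sub_le {u : Fin n → ℝ} {i : Fin n} {a : A}
    (ha : a ∈ M.optimalActions u i) (x : Fin n → ℝ) :
    M.transExt i a ⬝ᵥ (x - u) ≤ M.dpOperator x i - M.dpOperator u i := by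
  rw [dotProduct_sub, ← ha.2]
  linarith [M.reward_add_le_dpOperator x ha.1]

/-- The rule `τ` plays almost surely, in each state, an action optimal for `u`. -/
def StationaryRule.IsOptimal (τ : M.StationaryRule) (u : Fin n → ℝ) : Prop :=
  ∀ i, ∀ᵐ a ∂τ.law i, a ∈ M.optimalActions u i

namespace StationaryRule

variable {τ : M.StationaryRule} {F : Finset (Fin n)} {u : Fin n → ℝ} {lam : ℝ} {i : Fin n}

theorem integrable_transExt_dotProduct (τ : M.StationaryRule) (i : Fin n) (u : Fin n → ℝ) :
    Integrable (fun a => M.transExt i a ⬝ᵥ u) (τ.law i) :=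
  M.integrable_transExt_dotProduct measurable_prodMk_left u

theorem integrable_rewardExt (h : ∀ᵐ a ∂τ.law i, a ∈ M.optimalActions u i) :
    Integrable (M.rewardExt i) (τ.law i) := by
  refine ((integrable_const (M.dpOperator u i)).sub
    (τ.integrable_transExt_dotProduct i u)).congr ?_
  filter_upwards [h] with a ha using sub_eq_of_eq_add ha.2.symm

theorem expectedReward_add_mulVec_eq_integral (hint : Integrable (M.rewardExt i) (τ.law i)) :
    τ.expectedReward i + (τ.transMatrix *ᵥ u) i =
      ∫ a, (M.rewardExt i a + M.transExt i a ⬝ᵥ u) ∂τ.law i := by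
  rw [transMatrix_mulVec, expectedReward,
    integral_add hint (τ.integrable_transExt_dotProduct i u)]

theorem integral_slack (hint : Integrable (M.rewardExt i) (τ.law i)) :
    ∫ a, (M.dpOperator u i - (M.rewardExt i a + M.transExt i a ⬝ᵥ u)) ∂τ.law i =
      M.dpOperator u i - (τ.expectedReward i + (τ.transMatrix *ᵥ u) i) := by
  have hsum : Integrable (fun a => M.rewardExt i a + M.transExt i a ⬝ᵥ u) (τ.law i) :=
    hint.add (τ.integrable_transExt_dotProduct i u)
  rw [expectedReward_add_mulVec_eq_integral hint, integral_sub (integrable_const _) hsum,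
    integral_const, probReal_univ, one_smul]

theorem slack_nonneg (τ : M.StationaryRule) (u : Fin n → ℝ) (i : Fin n) :
    0 ≤ᵐ[τ.law i] fun a => M.dpOperator u i - (M.rewardExt i a + M.transExt i a ⬝ᵥ u) := by
  filter_upwards [τ.ae_mem_act i] with a ha
    using sub_nonneg.2 (M.reward_add_le_dpOperator u ha)

theorem expectedReward_add_mulVec_le (hint : Integrable (M.rewardExt i) (τ.law i)) :
    τ.expectedReward i + (τ.transMatrix *ᵥ u) i ≤ M.dpOperator u i :=
  sub_nonneg.1 <| integral_slack hint ▸ integral_nonneg_of_ae (τ.slack_nonneg u i)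

theorem expectedReward_add_mulVec_eq_iff (hint : Integrable (M.rewardExt i) (τ.law i)) :
    τ.expectedReward i + (τ.transMatrix *ᵥ u) i = M.dpOperator u i ↔
      ∀ᵐ a ∂τ.law i, a ∈ M.optimalActions u i := by
  have hslack := (integrable_const (M.dpOperator u i)).sub
    (hint.add (τ.integrable_transExt_dotProduct i u))
  rw [eq_comm, ← sub_eq_zero, ← integral_slack hint]
  refine (integral_eq_zero_iff_of_nonneg_ae (τ.slack_nonneg u i) hslack).trans ?_
  refine eventually_congr ?_
  filter_upwards [τ.ae_mem_act i] with a ha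
  simp only [optimalActions, Set.mem_ofPred_eq, ha, true_and, Pi.zero_apply, sub_eq_zero]
  exact eq_comm

theorem classReward_eq_iff (hu : IsAddEigenvector M.dpOperator lam u)
    (hF : IsFinalClass τ.transMatrix F) :
    τ.classReward F = lam ↔ ∀ i ∈ F, ∀ᵐ a ∂τ.law i, a ∈ M.optimalActions u i := by
  by_cases hint : ∀ i ∈ F, Integrable (M.rewardExt i) (τ.law i)
  · obtain ⟨i, hi⟩ := hF.nonempty
    have hle (j : Fin n) (hj : j ∈ F) :
        τ.expectedReward j + (τ.transMatrix *ᵥ u) j ≤ lam + u j :=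
      (expectedReward_add_mulVec_le (hint j hj)).trans_eq (hu j)
    rw [τ.classReward_eq_cesaroLimit hF hi hint, EReal.coe_eq_coe_iff,
      hF.cesaroLimit_mulVec_apply_eq_iff τ.transMatrix_mem_rowStochastic hi hle]
    refine forall₂_congr fun j hj => ?_
    rw [← hu j, expectedReward_add_mulVec_eq_iff (hint j hj)]
  · refine iff_of_false ?_ fun h => hint fun i hi => integrable_rewardExt (h i hi)
    push Not at hint
    obtain ⟨i, hi, hnot⟩ := hint
    rw [τ.classReward_eq_bot hF hi hnot]
    exact EReal.bot_ne_coe lam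

end StationaryRule

end MarkovControlModel

/-! ### Subgradients and optimal actions -/

theorem isCompact_convexHull {E : Type*} [AddCommGroup E] [Module ℝ E] [TopologicalSpace E]
    [ContinuousAdd E] [ContinuousSMul ℝ E] [FiniteDimensional ℝ E] {s : Set E}
    (hs : IsCompact s) : IsCompact (convexHull ℝ s) := by
  let combo (k : ℕ) (p : (Fin k → ℝ) × (Fin k → E)) : E := ∑ l, p.1 l • p.2 l
  let simplices (k : ℕ) := stdSimplex ℝ (Fin k) ×ˢ Set.univ.pi fun _ : Fin k => s
  -- Carathéodory: combinations of at most `finrank ℝ E + 1` points suffice.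
  have heq : convexHull ℝ s =
      ⋃ k ∈ Set.Iic (Module.finrank ℝ E + 1), combo k '' simplices k := by
    apply Set.Subset.antisymm
    · intro x hx
      obtain ⟨ι, _, z, w, hz, hind, hw, hw1, hx⟩ := eq_pos_convex_span_of_mem_convexHull hx
      let e := (Fintype.equivFin ι).symm
      refine Set.mem_biUnion (x := Fintype.card ι) (hind.card_le_finrank_succ.trans
        (Nat.add_le_add_right (Submodule.finrank_le _) 1)) ⟨(w ∘ e, z ∘ e), ⟨⟨?_, ?_⟩, ?_⟩, ?_⟩
      · exact fun l => (hw _).le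
      · exact (e.sum_comp w).trans hw1
      · exact fun l _ => hz ⟨e l, rfl⟩
      · exact (e.sum_comp fun i => w i • z i).trans hx
    · refine Set.iUnion₂_subset fun k _ => ?_
      rintro _ ⟨⟨w, z⟩, ⟨hw, hz⟩, rfl⟩
      exact mem_convexHull_iff_exists_fintype.2
        ⟨Fin k, inferInstance, w, z, hw.1, hw.2, fun l => hz l (Set.mem_univ l), rfl⟩
  rw [heq]
  exact (Set.finite_Iic _).isCompact_biUnion fun k _ =>
    ((isCompact_stdSimplex ℝ (Fin k)).prod (isCompact_univ_pi fun _ => hs)).image (by fun_prop)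

theorem mem_closure_convexHull_image_of_forall_exists_le {T E : Type*} [TopologicalSpace T]
    [CompactSpace T] [AddCommGroup E] [Module ℝ E] [TopologicalSpace E] [IsTopologicalAddGroup E]
    [ContinuousSMul ℝ E] [LocallyConvexSpace ℝ E] {g : T → ℝ} {p : T → E} {q : E} {c : ℝ}
    (hg : Continuous g) (hp : Continuous p) (hgc : ∀ t, g t ≤ c)
    (h : ∀ ℓ : StrongDual ℝ E, ∃ t, c + ℓ q ≤ g t + ℓ (p t)) :
    q ∈ closure (convexHull ℝ (p '' {t | g t = c})) := by
  -- Otherwise a linear form `ℓ` separates `q` from the closure. The points obtained for `ε • ℓ`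
  -- accumulate, as `ε → 0`, at a maximizer `t₀` of `g` with `ℓ q ≤ ℓ (p t₀)`.
  by_contra hq
  obtain ⟨ℓ, s, hs, hsq⟩ := geometric_hahn_banach_closed_point (convex_convexHull ℝ _).closure
    isClosed_closure hq
  choose t ht using fun ε : ℝ => h (ε • ℓ)
  let U : Ultrafilter ℝ := Ultrafilter.of (𝓝[>] 0)
  have hU : (U : Filter ℝ) ≤ 𝓝[>] 0 := Ultrafilter.of_le _
  have hid : Tendsto id (U : Filter ℝ) (𝓝 0) := hU.trans nhdsWithin_le_nhds
  obtain ⟨t₀, -, htend⟩ := isCompact_univ.ultrafilter_le_nhds (U.map t) (by simp)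
  have hgt : Tendsto (fun ε => g (t ε)) U (𝓝 (g t₀)) := (hg.tendsto t₀).comp htend
  have hpt : Tendsto (fun ε => ℓ (p (t ε))) U (𝓝 (ℓ (p t₀))) :=
    ((ℓ.continuous.comp hp).tendsto t₀).comp htend
  have hmax : c ≤ g t₀ := by
    refine le_of_tendsto_of_tendsto (b := (U : Filter ℝ)) (f := fun ε => c + ε * ℓ q)
      (g := fun ε => g (t ε) + ε * ℓ (p (t ε))) ?_ ?_ (.of_forall ht)
    · simpa using (hid.mul_const (ℓ q)).const_add c
    · simpa using hgt.add (hid.mul hpt)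
  have hle : ℓ q ≤ ℓ (p t₀) := by
    refine ge_of_tendsto hpt ?_
    filter_upwards [hU self_mem_nhdsWithin] with ε hε
    have hcomp : c + ε * ℓ q ≤ g (t ε) + ε * ℓ (p (t ε)) := ht ε
    exact le_of_mul_le_mul_left (by linarith [hgc (t ε)]) hε
  have hlt := hs _ (subset_closure (subset_convexHull ℝ _ ⟨t₀, (hgc t₀).antisymm hmax, rfl⟩))
  linarith

theorem exists_isProbabilityMeasure_integral_eq {A E : Type*} [MeasurableSpace A]
    [NormedAddCommGroup E] [NormedSpace ℝ E] [CompleteSpace E] {s : Set A} (hs : MeasurableSet s)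
    {f : A → E} (hf : StronglyMeasurable f) {x : E} (hx : x ∈ convexHull ℝ (f '' s)) :
    ∃ ν : Measure A, IsProbabilityMeasure ν ∧ (∀ᵐ a ∂ν, a ∈ s) ∧ Integrable f ν ∧
      ∫ a, f a ∂ν = x := by
  suffices h : convexHull ℝ (f '' s) ⊆ {x | ∃ ν : Measure A, IsProbabilityMeasure ν ∧
      (∀ᵐ a ∂ν, a ∈ s) ∧ Integrable f ν ∧ ∫ a, f a ∂ν = x} from h hx
  refine convexHull_min ?_ ?_
  · rintro _ ⟨a, ha, rfl⟩
    exact ⟨Measure.dirac a, inferInstance, (ae_dirac_iff hs).2 ha,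
      integrable_dirac' hf enorm_lt_top, integral_dirac' f a hf⟩
  · rintro _ ⟨ν, _, hν, hint, rfl⟩ _ ⟨ν', _, hν', hint', rfl⟩ α β hα hβ hαβ
    have hi := hint.smul_measure (c := ENNReal.ofReal α) ENNReal.ofReal_ne_top
    have hi' := hint'.smul_measure (c := ENNReal.ofReal β) ENNReal.ofReal_ne_top
    refine ⟨ENNReal.ofReal α • ν + ENNReal.ofReal β • ν', ⟨?_⟩, ?_, hi.add_measure hi', ?_⟩
    · simp [← ENNReal.ofReal_add hα hβ, hαβ]
    · exact ae_add_measure_iff.2 ⟨Measure.ae_smul_measure hν _, Measure.ae_smul_measure hν' _⟩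
    · rw [integral_add_measure hi hi', integral_smul_measure, integral_smul_measure,
        ENNReal.toReal_ofReal hα, ENNReal.toReal_ofReal hβ]

namespace MarkovControlModel

variable {n : ℕ} {A : Type*} [TopologicalSpace A] [MeasurableSpace A] [BorelSpace A]
  {M : MarkovControlModel n A} {u : Fin n → ℝ} {lam : ℝ}

theorem mem_convexHull_transExt_image {i : Fin n} (hc : IsCompact (M.act i))
    (hr : Continuous (M.reward i)) (ht : Continuous (M.trans i)) {q : Fin n → ℝ}
    (hq : ∀ x, q ⬝ᵥ (x - u) ≤ M.dpOperator x i - M.dpOperator u i) :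
    q ∈ convexHull ℝ (M.transExt i '' M.optimalActions u i) := by
  have : CompactSpace (M.act i) := isCompact_iff_compactSpace.1 hc
  have hreward (a : M.act i) : M.rewardExt i a = M.reward i a := dif_pos a.2
  have htrans (a : M.act i) : M.transExt i a = M.trans i a := dif_pos a.2
  have hp : Continuous fun a : M.act i => M.transExt i a := by
    simp only [htrans]
    exact continuous_subtype_val.comp ht
  have hg : Continuous fun a : M.act i => M.rewardExt i a + M.transExt i a ⬝ᵥ u := by
    simp only [hreward]
    exact hr.add (hp.dotProduct continuous_const)
  have himage : (fun a : M.act i => M.transExt i a) ''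
      {a | M.rewardExt i a + M.transExt i a ⬝ᵥ u = M.dpOperator u i} =
        M.transExt i '' M.optimalActions u i := by
    ext y
    simp [optimalActions, and_assoc, and_left_comm]
  rw [← himage, ← (isCompact_convexHull
    ((isClosed_eq hg continuous_const).isCompact.image hp)).isClosed.closure_eq]
  refine mem_closure_convexHull_image_of_forall_exists_le hg hp
    (fun a => M.reward_add_le_dpOperator u a.2) fun ℓ => ?_
  obtain ⟨y, hy⟩ := (dotProductEquiv ℝ (Fin n)).surjective (ℓ : (Fin n → ℝ) →ₗ[ℝ] ℝ)
  have hℓ (x : Fin n → ℝ) : ℓ x = x ⬝ᵥ y := by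
    rw [dotProduct_comm]
    exact (LinearMap.congr_fun hy x).symm
  obtain ⟨a, ha, hopt⟩ := M.exists_eq_dpOperator (u + y) i
  refine ⟨⟨a, ha⟩, ?_⟩
  have hsub := hq (u + y)
  rw [add_sub_cancel_left, ← hopt, dotProduct_add] at hsub
  simp only [hℓ]
  linarith

namespace StationaryRule

variable {τ : M.StationaryRule} {F : Finset (Fin n)}

theorem exists_forall_law {p : Fin n → Measure A → Prop}
    (h : ∀ i, ∃ ν, IsProbabilityMeasure ν ∧ (∀ᵐ a ∂ν, a ∈ M.act i) ∧ p i ν) :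
    ∃ τ : M.StationaryRule, ∀ i, p i (τ.law i) := by
  choose ν hprob hact hp using h
  exact ⟨⟨ν, hprob, fun i => (prob_compl_eq_zero_iff (M.measurableSet_act i)).1 (hact i)⟩, hp⟩

theorem exists_isOptimal (M : MarkovControlModel n A) (u : Fin n → ℝ) :
    ∃ τ : M.StationaryRule, τ.IsOptimal u := by
  refine exists_forall_law (p := fun i ν => ∀ᵐ a ∂ν, a ∈ M.optimalActions u i) fun i => ?_
  obtain ⟨a, ha, hopt⟩ := M.exists_eq_dpOperator u i
  exact ⟨Measure.dirac a, inferInstance, (ae_dirac_iff (M.measurableSet_act i)).2 ha,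
    (ae_dirac_iff (M.measurableSet_optimalActions u i)).2 ⟨ha, hopt⟩⟩

theorem exists_isOptimal_eqOn
    (h : ∀ i ∈ F, ∀ᵐ a ∂τ.law i, a ∈ M.optimalActions u i) :
    ∃ σ : M.StationaryRule, σ.IsOptimal u ∧ ∀ i ∈ F, σ.law i = τ.law i := by
  obtain ⟨σ, hσ⟩ := exists_isOptimal M u
  refine (exists_forall_law (p := fun i ν => (∀ᵐ a ∂ν, a ∈ M.optimalActions u i) ∧
    (i ∈ F → ν = τ.law i)) fun i => ?_).imp fun _ => forall_and.1
  by_cases hi : i ∈ F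
  · exact ⟨τ.law i, inferInstance, τ.ae_mem_act i, h i hi, fun _ => rfl⟩
  · exact ⟨σ.law i, inferInstance, σ.ae_mem_act i, hσ i, fun hiF => absurd hiF hi⟩

theorem IsOptimal.transMatrix_mem_subdifferential (h : τ.IsOptimal u) :
    τ.transMatrix ∈ subdifferential M.dpOperator u := by
  intro x i
  rw [transMatrix_mulVec]
  calc ∫ a, M.transExt i a ⬝ᵥ (x - u) ∂τ.law i
      ≤ ∫ _, (M.dpOperator x i - M.dpOperator u i) ∂τ.law i := by
        refine integral_mono_ae (τ.integrable_transExt_dotProduct i _) (integrable_const _) ?_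
        filter_upwards [h i] with a ha using transExt_dotProduct_sub_le ha x
    _ = (M.dpOperator x - M.dpOperator u) i := by simp

theorem exists_isOptimal_transMatrix_eq (hc : ∀ i, IsCompact (M.act i))
    (hr : ∀ i, Continuous (M.reward i)) (ht : ∀ i, Continuous (M.trans i))
    {P : Matrix (Fin n) (Fin n) ℝ} (hP : P ∈ subdifferential M.dpOperator u) :
    ∃ τ : M.StationaryRule, τ.IsOptimal u ∧ τ.transMatrix = P := by
  obtain ⟨τ, hτ⟩ := exists_forall_law (M := M)
      (p := fun i ν => (∀ᵐ a ∂ν, a ∈ M.optimalActions u i) ∧ ∫ a, M.transExt i a ∂ν = P i)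
    fun i => by
      obtain ⟨ν, hν, hopt, -, hmean⟩ := exists_isProbabilityMeasure_integral_eq
        (M.measurableSet_optimalActions u i)
        (measurable_pi_lambda _ (M.measurable_transExt i)).stronglyMeasurable
        (mem_convexHull_transExt_image (hc i) (hr i) (ht i) fun x => hP x i)
      exact ⟨ν, hν, hopt.mono fun a ha => ha.1, hopt, hmean⟩
  refine ⟨τ, fun i => (hτ i).1, funext fun i => funext fun j => ?_⟩
  rw [← (hτ i).2, eval_integral fun k => τ.integrable_transExt i k]
  rfl

theorem exists_meanReward_eq (hn : 0 < n) (hu : IsAddEigenvector M.dpOperator lam u) :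
    ∃ (τ : M.StationaryRule) (i : Fin n), τ.toStrategy.meanReward i = lam := by
  obtain ⟨τ, hτ⟩ := exists_isOptimal M u
  obtain ⟨F, hF, -⟩ := exists_isFinalClass_hasAccess τ.transMatrix ⟨0, hn⟩
  obtain ⟨i, hi⟩ := hF.nonempty
  exact ⟨τ, i, (τ.meanReward_eq_classReward hF hi).trans
    ((classReward_eq_iff hu hF).2 fun j _ => hτ j)⟩

end StationaryRule

theorem Strategy.meanReward_le_of_isAddEigenvector (hu : IsAddEigenvector M.dpOperator lam u)
    (γ : M.Strategy) (i : Fin n) : γ.meanReward i ≤ lam :=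
  γ.meanReward_le i fun j _ ha => (M.reward_add_le_dpOperator u ha).trans_eq (hu j)

theorem criticalFinalClasses_dpOperator (hu : IsAddEigenvector M.dpOperator lam u)
    (hc : ∀ i, IsCompact (M.act i)) (hr : ∀ i, Continuous (M.reward i))
    (ht : ∀ i, Continuous (M.trans i)) :
    criticalFinalClasses M.dpOperator u = {F | ∃ τ : M.StationaryRule,
      IsFinalClass τ.transMatrix F ∧ τ.classReward F = (lam : EReal)} := by
  ext F
  constructor
  · rintro ⟨P, hP, hF⟩
    obtain ⟨τ, hτ, rfl⟩ := StationaryRule.exists_isOptimal_transMatrix_eq hc hr ht hP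
    exact ⟨τ, hF, (StationaryRule.classReward_eq_iff hu hF).2 fun i _ => hτ i⟩
  · rintro ⟨τ, hF, hreward⟩
    obtain ⟨σ, hσ, hlaw⟩ := StationaryRule.exists_isOptimal_eqOn
      ((StationaryRule.classReward_eq_iff hu hF).1 hreward)
    refine ⟨σ.transMatrix, hσ.transMatrix_mem_subdifferential, hF.of_row_eq fun i hi => ?_⟩
    funext j
    simp only [StationaryRule.transMatrix, hlaw i hi]

end MarkovControlModel

theorem proposition7p2 {n : ℕ} (hn : 0 < n) {A : Type*} [TopologicalSpace A] [MeasurableSpace A]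
    [BorelSpace A] (M : MarkovControlModel n A) (u : Fin n → ℝ) (lam : ℝ)
    (hu : IsAddEigenvector M.dpOperator lam u) :
    IsGreatest (Set.range fun p : M.Strategy × Fin n => p.1.meanReward p.2) (lam : EReal) ∧
    IsGreatest (Set.range fun p : M.StationaryRule × Fin n => p.1.toStrategy.meanReward p.2)
      (lam : EReal) ∧
    (∀ (τ : M.StationaryRule) (F : Finset (Fin n)), IsFinalClass τ.transMatrix F →
      ∃! m, IsInvariantMeasureOn τ.transMatrix F m) ∧
    (∀ τ : M.StationaryRule, ∃ v : EReal,
      IsGreatest (Set.range fun i : Fin n => τ.toStrategy.meanReward i) v ∧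
      IsGreatest (τ.classReward '' {F | IsFinalClass τ.transMatrix F}) v) ∧
    ((∀ i, IsCompact (M.act i)) → (∀ i, Continuous (M.reward i)) →
      (∀ i, Continuous (M.trans i)) →
      criticalFinalClasses M.dpOperator u =
        {F | ∃ τ : M.StationaryRule, IsFinalClass τ.transMatrix F ∧
          τ.classReward F = (lam : EReal)}) := by
  have hle (γ : M.Strategy) (i : Fin n) : γ.meanReward i ≤ lam :=
    MarkovControlModel.Strategy.meanReward_le_of_isAddEigenvector hu γ i
  obtain ⟨τ, i, hτ⟩ := MarkovControlModel.StationaryRule.exists_meanReward_eq hn hu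
  refine ⟨⟨⟨(τ.toStrategy, i), hτ⟩, ?_⟩, ⟨⟨(τ, i), hτ⟩, ?_⟩,
    fun σ F hF => hF.existsUnique_isInvariantMeasureOn σ.transMatrix_mem_rowStochastic,
    fun σ => σ.exists_isGreatest_meanReward_classReward hn,
    MarkovControlModel.criticalFinalClasses_dpOperator hu⟩
  · rintro _ ⟨⟨γ, j⟩, rfl⟩
    exact hle γ j
  · rintro _ ⟨⟨σ, j⟩, rfl⟩
    exact hle σ.toStrategy j
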